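/- Let $L=\{r\}$ be the language of graphs and let $T$ be the theory of the random graph: the axioms of (irreflexive, symmetric) graphs together with the extension axioms, saying for every $k$ and every $S\subseteq\{1,\dots,k\}$ that for all pairwise distinct vertices $x_1,\dots,x_k$ there is a vertex $z$, distinct from all $x_i$, which is adjacent to $x_i$ for $i\in S$ and not adjacent to $x_i$ for $i\notin S$. Let $N$ be a countable model of $T$ (the countable random graph). Let $L_0=L\cup\{f,f^{-1}\}$ with two unary function symbols, and let $T_0$ be $T$ together with the sentence saying that $f$ is an automorphism of the graph with inverse $f^{-1}$. Let $\mathrm{Exp}(N,T_0)$ be the set of the expansions $\sigma$ of $N$ (interpretations of $f,f^{-1}$ in $N$) with $(N,\sigma)\models T_0$, with the topology generated by the sets $[\varphi]_N=\{\sigma:(N,\sigma)\models\varphi\}$, where $\varphi$ is a quantifier-free $L_0$-sentence with parameters in $N$. Call $\sigma\in\mathrm{Exp}(N,T_0)$ * existentially closed if every quantifier-free $L_0$-formula with parameters in $N$ that has a solution in some $(U,\upsilon)$ with $(N,\sigma)\subseteq(U,\upsilon)\models T_0$ has a solution in $(N,\sigma)$; * smooth if $(N,\sigma)$ realizes every type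 $p(x)\cup\{\psi(x)\}$ that is finitely consistent in $(N,\sigma)$, where $p(x)$ is a type in $L$ and $\psi(x)$ is a quantifier-free $L_0$-formula, with finitely many parameters from $N$ in all. Let $Y$ be the set of the existentially closed smooth $\sigma\in\mathrm{Exp}(N,T_0)$. For a finite tuple $b$ in $N$ and $\alpha\in Y$, the 1-diagram $\mathrm{diag}_{\restriction 1}(\alpha,b)$ is the set of all $\varphi(b)$ such that $\varphi(x)$ is a universal or existential $L_0$-formula without parameters and $(N,\alpha)\models\varphi(b)$. Let $D_b=\{\mathrm{diag}_{\restriction 1}(\alpha,b):\alpha\in Y\}$, with the topology whose basic open sets are $$[\pi(b)]_D=\{\mathrm{diag}_{\restriction 1}(\alpha,b):\alpha\in Y,\ (N,\alpha)\models\pi(b)\},$$ where $\pi(x)$ has the form $\exists y\,[p(x,y)\wedge\varphi(x,y)]$ with $p(x,y)$ a parameter-free type in $L$ and $\varphi(x,y)$ a parameter-free quantifier-free $L_0$-formula. The isolated points of $D_b$ are called e-isolated. Finally, $\tau\in\mathrm{Exp}(N,T_0)$ is Truss generic if $\{\tau^g:g\in\mathrm{Aut}(N)\}$ is comeagre in $\mathrm{Exp}(N,T_0)$,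 where $\mathrm{Aut}(N)$ is the group of automorphisms of the graph $N$ and $\tau^g$ is the expansion that makes $g:(N,\tau)\to(N,\tau^g)$ an isomorphism. Then: 1. for every finite tuple $b$ in $N$, the e-isolated points are dense in $D_b$; 2. there exists a Truss generic $\tau\in\mathrm{Exp}(N,T_0)$, that is, Truss generic automorphisms of the random graph exist. -/

import Mathlib

open FirstOrder

namespace TrussGeneric

open FirstOrder.Language

universe u

section General

/-! ### Expansions of an `L`-structure to a larger signature

`L` is the base language, `L'` the language of the new symbols, and `L.sum L'` the expanded
language.  An expansion of an `L`-structure `N` is the same as an `L'`-structure on `N`. -/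

variable {L L' : FirstOrder.Language.{0, 0}}

/-- The `L.sum L'`-structure `(N, σ)`. -/
@[reducible]
def expand {N : Type u} [L.Structure N] (σ : L'.Structure N) : (L.sum L').Structure N :=
  letI := σ
  Language.sumStructure L L' N

/-- Satisfaction of the formula `φ` in `(N, σ)` under the assignment `v`. -/
def Sat {N : Type u} [L.Structure N] (σ : L'.Structure N) {α : Type*}
    (φ : (L.sum L').Formula α) (v : α → N) : Prop :=
  letI := expand (L := L) σ
  φ.Realize v

/-- `(N, σ)` is a model of `T₀`. -/
def Models {N : Type u} [L.Structure N] (σ : L'.Structure N) (T₀ : (L.sum L').Theory) : Prop :=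
  letI := expand (L := L) σ
  N ⊨ T₀

/-- `Exp(N, T₀)`: the expansions `σ` of `N` such that `(N, σ)` is a model of `T₀`. -/
@[ext]
structure Exp (N : Type u) [L.Structure N] (T₀ : (L.sum L').Theory) : Type u where
  /-- the interpretation of the new symbols -/
  str : L'.Structure N
  models : Models str T₀

/-- The topology of `Exp(N, T₀)` is generated by the sets `[φ]_N` of expansions satisfying the
quantifier-free sentence `φ` with parameters in `N`.  A sentence with parameters is a formula with
variables indexed by `N`, where the variable `a` is interpreted as `a`. -/
instance {N : Type u} [L.Structure N] (T₀ : (L.sum L').Theory) : TopologicalSpace (Exp N T₀) :=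
  TopologicalSpace.generateFrom
    {S | ∃ φ : (L.sum L').Formula N, φ.IsQF ∧ S = {σ : Exp N T₀ | Sat σ.str φ id}}

/-- `σ` is existentially closed: every quantifier-free formula `φ(x)` with parameters in `N` that
has a solution in some model `(U, υ)` of `T₀` extending `(N, σ)` has a solution in `(N, σ)`. -/
def IsEC {N : Type u} [L.Structure N] {T₀ : (L.sum L').Theory} (σ : Exp N T₀) : Prop :=
  ∀ (n : ℕ) (φ : (L.sum L').Formula (N ⊕ Fin n)), φ.IsQF →
    (∃ (U : Type u) (_ : L.Structure U) (υ : Exp U T₀)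
      (j : letI := expand (L := L) σ.str
           letI := expand (L := L) υ.str
           N ↪[L.sum L'] U) (x : Fin n → U), Sat υ.str φ (Sum.elim j x)) →
    ∃ x : Fin n → N, Sat σ.str φ (Sum.elim id x)

/-- `σ` is smooth: `(N, σ)` realizes every type of the form `p(x) ∧ ψ(x)` that is finitely
consistent in `(N, σ)`, where `p` is an `L`-type and `ψ` is a quantifier-free formula of the
expanded language, both with parameters in a finite set `A`. -/
def IsSmooth {N : Type u} [L.Structure N] {T₀ : (L.sum L').Theory} (σ : Exp N T₀) : Prop :=
  ∀ (n : ℕ) (A : Finset N) (p : Set (L.Formula (A ⊕ Fin n)))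
    (ψ : (L.sum L').Formula (A ⊕ Fin n)), ψ.IsQF →
    (∀ q : Finset (L.Formula (A ⊕ Fin n)), (q : Set (L.Formula (A ⊕ Fin n))) ⊆ p →
      ∃ x : Fin n → N, (∀ ξ ∈ q, ξ.Realize (Sum.elim (fun a : A => (a : N)) x)) ∧
        Sat σ.str ψ (Sum.elim (fun a : A => (a : N)) x)) →
    ∃ x : Fin n → N, (∀ ξ ∈ p, ξ.Realize (Sum.elim (fun a : A => (a : N)) x)) ∧
      Sat σ.str ψ (Sum.elim (fun a : A => (a : N)) x)

/-- The set `Y` of existentially closed smooth expansions. -/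
def Y (N : Type u) [L.Structure N] (T₀ : (L.sum L').Theory) : Set (Exp N T₀) :=
  {σ | IsEC σ ∧ IsSmooth σ}

/-- The 1-diagram of `α` at `b`: the universal or existential formulas `φ(x)` of the expanded
language, without parameters, such that `φ(b)` holds in `(N, α)`. -/
def diag₁ {N : Type u} [L.Structure N] {T₀ : (L.sum L').Theory} (α : Exp N T₀) {n : ℕ}
    (b : Fin n → N) : Set ((L.sum L').Formula (Fin n)) :=
  {φ | (φ.IsUniversal ∨ φ.IsExistential) ∧ Sat α.str φ b}

/-- `D_b`: the set of 1-diagrams at `b` of the expansions in `Y`. -/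
@[ext]
structure D {N : Type u} [L.Structure N] (T₀ : (L.sum L').Theory) {n : ℕ} (b : Fin n → N) where
  /-- the 1-diagram as a set of formulas -/
  diag : Set ((L.sum L').Formula (Fin n))
  exists_eq : ∃ α ∈ Y N T₀, diag₁ α b = diag

/-- `(N, α)` satisfies at `b` the existential quasifinite formula `∃ y [p(x, y) ∧ φ(x, y)]`. -/
def SatQuasifinite {N : Type u} [L.Structure N] {T₀ : (L.sum L').Theory} (α : Exp N T₀) {n m : ℕ}
    (p : Set (L.Formula (Fin n ⊕ Fin m))) (φ : (L.sum L').Formula (Fin n ⊕ Fin m))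
    (b : Fin n → N) : Prop :=
  ∃ y : Fin m → N, (∀ ξ ∈ p, ξ.Realize (Sum.elim b y)) ∧ Sat α.str φ (Sum.elim b y)

/-- The topology of `D_b`: the basic open sets are `[π(b)]_D`, the set of the 1-diagrams at `b` of
the `α ∈ Y` satisfying `π(b)`, for `π(x) = ∃ y [p(x, y) ∧ φ(x, y)]` existential quasifinite, that
is, `p` a parameter-free `L`-type and `φ` a quantifier-free formula of the expanded language. -/
instance {N : Type u} [L.Structure N] (T₀ : (L.sum L').Theory) {n : ℕ} (b : Fin n → N) :
    TopologicalSpace (D T₀ b) :=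
  TopologicalSpace.generateFrom
    {S | ∃ (m : ℕ) (p : Set (L.Formula (Fin n ⊕ Fin m)))
        (φ : (L.sum L').Formula (Fin n ⊕ Fin m)), φ.IsQF ∧
        S = {d : D T₀ b | ∃ α ∈ Y N T₀, SatQuasifinite α p φ b ∧ diag₁ α b = d.diag}}

/-- A point of `D_b` is e-isolated if it is an isolated point of the space `D_b`. -/
def IsEIsolated {N : Type u} [L.Structure N] {T₀ : (L.sum L').Theory} {n : ℕ} {b : Fin n → N}
    (d : D T₀ b) : Prop :=
  IsOpen ({d} : Set (D T₀ b))

/-- The conjugate `σ^g`: the expansion making `g : (N, σ) → (N, σ^g)` an isomorphism. -/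
@[reducible]
def conj {N : Type u} [L.Structure N] (g : N ≃[L] N) (σ : L'.Structure N) : L'.Structure N :=
  letI := σ
  g.toEquiv.inducedStructure

/-- `τ` is Truss generic: its conjugates by the automorphisms of the `L`-structure `N` form a
comeagre subset of `Exp(N, T₀)`. -/
def IsTrussGeneric {N : Type u} [L.Structure N] {T₀ : (L.sum L').Theory} (τ : Exp N T₀) : Prop :=
  {σ : Exp N T₀ | ∃ g : N ≃[L] N, σ.str = conj g τ.str} ∈ residual (Exp N T₀)

end General

/-! ### The random graph with an automorphism -/

/-- The extension axiom of the random graph for `k` and `S ⊆ {0, …, k - 1}`: for all pairwise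
distinct vertices `x₀, …, xₖ₋₁` there is a vertex `z`, distinct from all of them, that is adjacent
to `xᵢ` for `i ∈ S` and not adjacent to `xᵢ` for `i ∉ S`. -/
noncomputable def extensionAxiom (k : ℕ) (S : Finset (Fin k)) : Language.graph.Sentence :=
  BoundedFormula.alls (n := k) <|
    (BoundedFormula.iInf fun q : {q : Fin k × Fin k // q.1 ≠ q.2} =>
      ∼((&q.1.1 : Language.graph.Term (Empty ⊕ Fin k)) =' &q.1.2)) ⟹
    ∃' ((BoundedFormula.iInf fun i : Fin k =>
          ∼((&i.castSucc : Language.graph.Term (Empty ⊕ Fin (k + 1))) =' &(Fin.last k))) ⊓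
        ((BoundedFormula.iInf fun i : {i : Fin k // i ∈ S} =>
            adj.boundedFormula₂ (&i.1.castSucc) (&(Fin.last k))) ⊓
          (BoundedFormula.iInf fun i : {i : Fin k // i ∉ S} =>
            ∼(adj.boundedFormula₂ (&i.1.castSucc) (&(Fin.last k))))))

/-- The theory of the random graph: simple graphs satisfying all extension axioms. -/
def randomGraph : Language.graph.Theory :=
  Theory.simpleGraph ∪ {φ | ∃ (k : ℕ) (S : Finset (Fin k)), φ = extensionAxiom k S}

/-- Two unary function symbols, for `f` and `f⁻¹`. -/
inductive AutFunctions : ℕ → Type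
  | f : AutFunctions 1
  | fInv : AutFunctions 1

/-- The language of the new symbols `f` and `f⁻¹`. -/
abbrev autLang : FirstOrder.Language := ⟨AutFunctions, fun _ => Empty⟩

/-- The language of graphs with `f` and `f⁻¹`. -/
abbrev graphAut : FirstOrder.Language := Language.graph.sum autLang

abbrev adjSym : graphAut.Relations 2 := Sum.inl adj

abbrev fSym : graphAut.Functions 1 := Sum.inr AutFunctions.f

abbrev fInvSym : graphAut.Functions 1 := Sum.inr AutFunctions.fInv

/-- The sentence saying that `f` is an automorphism with inverse `f⁻¹`. -/
def autAxiom : graphAut.Sentence :=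
  (∀' ((fSym.apply₁ (fInvSym.apply₁ (&0)) =' (&0 : graphAut.Term (Empty ⊕ Fin 1))) ⊓
      (fInvSym.apply₁ (fSym.apply₁ (&0)) =' (&0 : graphAut.Term (Empty ⊕ Fin 1))))) ⊓
  (∀' ∀' ((adjSym.boundedFormula₂ (&0 : graphAut.Term (Empty ⊕ Fin 2)) (&1)).iff
      (adjSym.boundedFormula₂ (fSym.apply₁ (&0)) (fSym.apply₁ (&1)))))

/-- The theory of the random graph together with the sentence saying that `f` is an automorphism
with inverse `f⁻¹`. -/
def randomGraphAut : graphAut.Theory :=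
  (LHom.sumInl : Language.graph →ᴸ graphAut).onTheory randomGraph ∪ {autAxiom}

end TrussGeneric

/-! Call an automorphism generic (`IsGenericAut`) if its orbits are finite and every finite graph
with an automorphism embeds over each invariant part already embedded. Generic automorphisms play
the role of the Fraïssé limit of the finite graphs with an automorphism: any two are conjugate, by
back-and-forth through finite invariant partial isomorphisms (`IsGenericAut.exists_equiv`).
Genericity amounts to countably many open dense conditions (`isGenericAut_mem_residual`), so generic
automorphisms exist in the Baire space `Exp`, and the conjugacy class of each is comeagre.

Density of these conditions rests on three facts. Every finite part of a graph with an automorphism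
occurs in a finite one (`exists_finite_preservesOn`): divide by a suitable power of the automorphism
and keep only the translates of the edges of that part. Graphs with an automorphism amalgamate
freely over invariant parts (`exists_amalgam`). By homogeneity of the countable random graph, a
finite solution can be put back into `N` without changing finitely many prescribed values
(`exists_aut_extending`).

For the 1-diagrams, a generic `τ` is existentially closed (`IsGenericAut.isEC`), and every expansion
of `N` is smooth (`isSmooth`). Let `A` be a finite invariant set containing `b`. An existentially
closed `α` in which the diagram of `τ` on `A` has a copy fixing `b` realizes over `b` the same
finite configurations as `τ`, by amalgamation over `A`. Hence that diagram isolates the 1-diagram of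
`τ` at `b` (`IsGenericAut.isEIsolated`). These points are dense because generic automorphisms are
dense and membership in an open set of 1-diagrams depends on finitely many values
(`exists_finset_of_isOpen`). -/

namespace TrussGeneric

open FirstOrder.Language FirstOrder.Language.Structure Topology TopologicalSpace

universe u v w

/-! ### Graphs with an automorphism and their finite quotients. -/

/-- A simple graph with an automorphism. -/
structure AutGraph (V : Type u) extends SimpleGraph V where
  /-- the automorphism -/
  aut : Equiv.Perm V
  adj_aut : ∀ x y, Adj (aut x) (aut y) ↔ Adj x y

/-- `h` preserves equality, adjacency and the automorphism, as far as they are visible in `W`. -/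
structure PreservesOn {V : Type u} {V' : Type v} (X : AutGraph V) (Y : AutGraph V') (h : V → V')
    (W : Set V) : Prop where
  inj : ∀ x ∈ W, ∀ y ∈ W, h x = h y → x = y
  adj : ∀ x ∈ W, ∀ y ∈ W, (Y.Adj (h x) (h y) ↔ X.Adj x y)
  aut : ∀ x ∈ W, X.aut x ∈ W → h (X.aut x) = Y.aut (h x)

section

variable {V : Type u} {V' : Type v} {V'' : Type w} {X : AutGraph V} {Y : AutGraph V'}
  {Z : AutGraph V''}

theorem PreservesOn.mono {h : V → V'} {W W' : Set V} (H : PreservesOn X Y h W) (hW : W' ⊆ W) :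
    PreservesOn X Y h W' :=
  ⟨fun x hx y hy => H.inj x (hW hx) y (hW hy), fun x hx y hy => H.adj x (hW hx) y (hW hy),
    fun x hx hx' => H.aut x (hW hx) (hW hx')⟩

theorem PreservesOn.comp {h : V → V'} {k : V' → V''} {W : Set V} {W' : Set V'}
    (K : PreservesOn Y Z k W') (H : PreservesOn X Y h W) (hW : Set.MapsTo h W W') :
    PreservesOn X Z (k ∘ h) W := by
  refine ⟨fun x hx y hy e => H.inj x hx y hy (K.inj _ (hW hx) _ (hW hy) e), fun x hx y hy =>
    (K.adj _ (hW hx) _ (hW hy)).trans (H.adj x hx y hy), fun x hx hx' => ?_⟩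
  have h1 := H.aut x hx hx'
  have h2 := K.aut (h x) (hW hx) (h1 ▸ hW hx')
  simp [h1, h2]

theorem AutGraph.adj_zpow (X : AutGraph V) (k : ℤ) (x y : V) :
    X.Adj ((X.aut ^ k) x) ((X.aut ^ k) y) ↔ X.Adj x y := by
  induction k with
  | zero => simp
  | succ n ih => rw [add_comm, zpow_add]; simpa [X.adj_aut] using ih
  | pred n ih =>
    rw [← ih, ← X.adj_aut ((X.aut ^ (-(n : ℤ) - 1)) x), sub_eq_add_neg, add_comm, zpow_add]
    simp

theorem AutGraph.adj_aut_symm (X : AutGraph V) (x y : V) :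
    X.Adj (X.aut.symm x) (X.aut.symm y) ↔ X.Adj x y := by
  rw [← X.adj_aut]; simp

theorem zpow_injective_of_not_periodic {f : Equiv.Perm V} {x : V}
    (hx : ¬∃ p : ℕ, 0 < p ∧ (f ^ p) x = x) {c d : ℤ} (h : (f ^ c) x = (f ^ d) x) : c = d := by
  by_contra hne
  apply hx
  have key : ∀ a b : ℤ, a < b → (f ^ a) x = (f ^ b) x → ∃ p : ℕ, 0 < p ∧ (f ^ p) x = x := by
    intro a b hab e
    refine ⟨(b - a).toNat, by omega, ?_⟩
    rw [← zpow_natCast, Int.toNat_of_nonneg (by omega), sub_eq_add_neg, add_comm, zpow_add,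
      Equiv.Perm.mul_apply, ← e, zpow_neg]
    simp
  rcases lt_or_gt_of_ne hne with hlt | hlt
  · exact key c d hlt h
  · exact key d c hlt h.symm

/-- For a suitable modulus `M`, congruence modulo `M` of exponents moving points of a finite set
into the set cannot be told from equality. -/
theorem exists_modulus (f : Equiv.Perm V) (W : Finset V) : ∃ M : ℕ, 0 < M ∧
    ∀ u ∈ W, ∀ u' ∈ W, ∀ x ∈ W, ∀ x' ∈ W, ∀ a b : ℤ, (f ^ a) u = x → (f ^ b) u' = x' →
      (M : ℤ) ∣ a - b → ∃ k : ℤ, (f ^ k) u = x ∧ (f ^ k) u' = x' := by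
  have hp : ∀ u : V, ∃ p : ℕ, 0 < p ∧ ((∃ p : ℕ, 0 < p ∧ (f ^ p) u = u) → (f ^ p) u = u) := by
    intro u
    by_cases h : ∃ p : ℕ, 0 < p ∧ (f ^ p) u = u
    · obtain ⟨p, h1, h2⟩ := h
      exact ⟨p, h1, fun _ => h2⟩
    · exact ⟨1, one_pos, fun h' => absurd h' h⟩
  choose p hp0 hp using hp
  have hD : ∀ u x : V, ∃ D : ℕ, (¬∃ p : ℕ, 0 < p ∧ (f ^ p) u = u) →
      ∀ d : ℤ, (f ^ d) u = x → |d| ≤ D := by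
    intro u x
    by_cases h : ∃ d : ℤ, (f ^ d) u = x
    · obtain ⟨d, hd⟩ := h
      refine ⟨d.natAbs, fun hu d' hd' => ?_⟩
      rw [zpow_injective_of_not_periodic hu (hd'.trans hd.symm)]
      simp
    · exact ⟨0, fun _ d hd => absurd ⟨d, hd⟩ h⟩
  choose D hD using hD
  -- For the periodic points of `W` exponents matter only modulo `K`. An exponent that moves a
  -- nonperiodic point of `W` into `W` is at most `S` in absolute value, so two such exponents
  -- congruent modulo a positive multiple of `2 * S + 1` are equal.
  set K := ∏ w ∈ W, p w with hK
  set S := ∑ w ∈ W, ∑ w' ∈ W, D w w' with hS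
  have hDS : ∀ u ∈ W, ∀ x ∈ W, D u x ≤ S := fun u hu x hx =>
    (Finset.single_le_sum (f := fun x => D u x) (fun _ _ => Nat.zero_le _) hx).trans
      (Finset.single_le_sum (f := fun u => ∑ x ∈ W, D u x) (fun _ _ => Nat.zero_le _) hu)
  have hK0 : 0 < K := Finset.prod_pos fun w _ => hp0 w
  refine ⟨K * (2 * S + 1), by positivity, ?_⟩
  intro u hu u' hu' x hx x' hx' a b ha hb hM
  have hfix : ∀ w ∈ W, (∃ p : ℕ, 0 < p ∧ (f ^ p) w = w) → (f ^ a) w = (f ^ b) w := by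
    intro w hw hper
    have h1 : (f ^ (p w)) w = w := hp w hper
    have h2 : ((p w : ℕ) : ℤ) ∣ a - b :=
      (Int.natCast_dvd_natCast.2 ((Finset.dvd_prod_of_mem p hw).trans (dvd_mul_right _ _))).trans hM
    obtain ⟨c, hc⟩ := h2
    have h3 : (f ^ (a - b)) w = w := by
      rw [hc, zpow_mul, zpow_natCast]
      exact Equiv.Perm.zpow_apply_eq_self_of_apply_eq_self h1 c
    have : a = b + (a - b) := by ring
    rw [this, zpow_add, Equiv.Perm.mul_apply, h3]
  by_cases h1 : ∃ p : ℕ, 0 < p ∧ (f ^ p) u = u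
  · exact ⟨b, (hfix u hu h1) ▸ ha, hb⟩
  by_cases h2 : ∃ p : ℕ, 0 < p ∧ (f ^ p) u' = u'
  · exact ⟨a, ha, (hfix u' hu' h2).symm ▸ hb⟩
  have ha' := (hD u x h1 a ha).trans (Int.ofNat_le.2 (hDS u hu x hx))
  have hb' := (hD u' x' h2 b hb).trans (Int.ofNat_le.2 (hDS u' hu' x' hx'))
  have hab : a = b := by
    by_contra hne
    have h3 := Int.le_of_dvd (by positivity : (0 : ℤ) < |a - b|)
      ((dvd_abs _ _).2 hM) |>.trans (abs_sub a b)
    have h4 : (2 * S + 1 : ℤ) ≤ ((K * (2 * S + 1) : ℕ) : ℤ) := by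
      push_cast
      nlinarith
    omega
  exact ⟨a, ha, hab ▸ hb⟩

/-- Every finite part of a graph with an automorphism occurs in a finite one. -/
theorem exists_finite_preservesOn [Nonempty V] (X : AutGraph V) (W : Finset V) :
    ∃ (C : Type u) (_ : Finite C) (Y : AutGraph C) (h : V → C), PreservesOn X Y h W := by
  classical
  obtain ⟨M, hM, core⟩ := exists_modulus X.aut W
  -- Points are identified along the powers of the `M`-th power of the automorphism, so each orbit
  -- leaves at most `M` classes.
  let s : Setoid V :=
    { r := fun x y => ∃ m : ℤ, (X.aut ^ (m * M)) x = y
      iseqv :=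
        ⟨fun x => ⟨0, by simp⟩, fun {x y} ⟨m, hm⟩ => ⟨-m, by rw [← hm, neg_mul, zpow_neg]; simp⟩,
          fun {x y z} ⟨m, hm⟩ ⟨k, hk⟩ => ⟨k + m, by rw [← hk, ← hm, add_mul, zpow_add]; simp⟩⟩ }
  have hs : ∀ x y, (Quotient.mk s x = Quotient.mk s y) ↔ ∃ m : ℤ, (X.aut ^ (m * M)) x = y :=
    fun x y => Quotient.eq (r := s)
  have hs1 : ∀ l : ℤ, ∀ x y, Quotient.mk s ((X.aut ^ l) x) = Quotient.mk s ((X.aut ^ l) y) ↔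
      Quotient.mk s x = Quotient.mk s y := by
    intro l x y
    rw [hs, hs]
    refine exists_congr fun m => ?_
    rw [← Equiv.Perm.mul_apply, ← zpow_add, add_comm, zpow_add, Equiv.Perm.mul_apply]
    exact (X.aut ^ l).injective.eq_iff
  let F : Equiv.Perm (Quotient s) := Quotient.congr X.aut fun x y => by
    have := hs1 1 x y
    rw [zpow_one, Quotient.eq, Quotient.eq] at this
    exact this.symm
  have hF : ∀ x, F (Quotient.mk s x) = Quotient.mk s (X.aut x) := fun x => rfl
  -- The point `x₀` supplies the value of `h` off `W`, also when `W` is empty.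
  let x₀ : V := Classical.arbitrary V
  let P : Quotient s → Prop := fun q => ∃ w ∈ insert x₀ W, ∃ k : ℤ, q = Quotient.mk s ((X.aut ^ k) w)
  have hP : ∀ q, P (F q) ↔ P q := by
    intro q
    constructor
    · rintro ⟨w, hw, k, hk⟩
      refine ⟨w, hw, k - 1, F.injective ?_⟩
      rw [hk, hF, ← Equiv.Perm.mul_apply, ← zpow_one_add]
      simp
    · rintro ⟨w, hw, k, rfl⟩
      exact ⟨w, hw, 1 + k, by rw [hF, zpow_one_add]; rfl⟩
  have hfin : Finite {q // P q} := by
    let φ : {x // x ∈ insert x₀ W} × Fin M → {q // P q} := fun t =>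
      ⟨Quotient.mk s ((X.aut ^ ((t.2 : ℕ) : ℤ)) t.1), t.1, t.1.2, _, rfl⟩
    refine Finite.of_surjective φ ?_
    rintro ⟨q, w, hw, k, rfl⟩
    have hM' : (0 : ℤ) < M := by exact_mod_cast hM
    have h1 := Int.emod_nonneg k hM'.ne'
    have h2 := Int.emod_lt_of_pos k hM'
    refine ⟨(⟨w, hw⟩, ⟨(k % M).toNat, by omega⟩), Subtype.ext ((hs _ _).2 ⟨k / M, ?_⟩)⟩
    simp only
    rw [← Equiv.Perm.mul_apply, ← zpow_add, Int.toNat_of_nonneg h1, mul_comm, Int.mul_ediv_add_emod]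
  -- Only translates of edges inside `W` survive: an edge between other representatives could join
  -- the classes of two nonadjacent points of `W`.
  let Y : AutGraph {q // P q} :=
    { Adj := fun q q' => ∃ x ∈ W, ∃ y ∈ W, ∃ l : ℤ, X.Adj x y ∧
        q.1 = Quotient.mk s ((X.aut ^ l) x) ∧ q'.1 = Quotient.mk s ((X.aut ^ l) y)
      symm := ⟨by
        rintro q q' ⟨x, hx, y, hy, l, h, h1, h2⟩
        exact ⟨y, hy, x, hx, l, h.symm, h2, h1⟩⟩
      loopless := ⟨by
        rintro q ⟨x, hx, y, hy, l, h, h1, h2⟩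
        obtain ⟨m, hm⟩ := (hs _ _).1 ((hs1 l x y).1 (h1.symm.trans h2))
        obtain ⟨k, hk1, hk2⟩ := core x hx x hx y hy x hx (m * M) 0 hm (by simp) (by simp)
        exact h.ne (hk2.symm.trans hk1)⟩
      aut := F.subtypePerm hP
      adj_aut := by
        rintro ⟨q, hq⟩ ⟨q', hq'⟩
        constructor
        · rintro ⟨x, hx, y, hy, l, h, h1, h2⟩
          refine ⟨x, hx, y, hy, l - 1, h, F.injective ?_, F.injective ?_⟩
          · refine h1.trans ?_
            rw [hF, ← Equiv.Perm.mul_apply, ← zpow_one_add]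
            simp
          · refine h2.trans ?_
            rw [hF, ← Equiv.Perm.mul_apply, ← zpow_one_add]
            simp
        · rintro ⟨x, hx, y, hy, l, h, h1, h2⟩
          refine ⟨x, hx, y, hy, 1 + l, h, ?_, ?_⟩
          · rw [zpow_one_add, Equiv.Perm.mul_apply, ← hF, ← h1]; rfl
          · rw [zpow_one_add, Equiv.Perm.mul_apply, ← hF, ← h2]; rfl }
  let h : V → {q // P q} := fun x =>
    if hx : x ∈ W then ⟨Quotient.mk s x, x, Finset.mem_insert_of_mem hx, 0, by simp⟩
    else ⟨Quotient.mk s x₀, x₀, Finset.mem_insert_self _ _, 0, by simp⟩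
  have hh : ∀ x ∈ W, (h x).1 = Quotient.mk s x := fun x hx => by simp [h, hx]
  refine ⟨{q // P q}, hfin, Y, h, ⟨?_, ?_, ?_⟩⟩
  · intro x hx y hy e
    have e' := congrArg Subtype.val e
    rw [hh x hx, hh y hy, hs] at e'
    obtain ⟨m, hm⟩ := e'
    obtain ⟨k, hk1, hk2⟩ := core x hx x hx y hy x hx (m * M) 0 hm (by simp) (by simp)
    exact hk2.symm.trans hk1
  · intro x hx y hy
    constructor
    · rintro ⟨x', hx', y', hy', l, hadj, h1, h2⟩
      rw [hh x hx, eq_comm, hs] at h1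
      rw [hh y hy, eq_comm, hs] at h2
      obtain ⟨m, hm⟩ := h1
      obtain ⟨m', hm'⟩ := h2
      rw [← Equiv.Perm.mul_apply, ← zpow_add] at hm hm'
      -- The exponents moving `x'` to `x` and `y'` to `y` agree modulo `M`, so a single power moves
      -- the edge `x' y'` to `x y`.
      obtain ⟨k, rfl, rfl⟩ := core x' hx' y' hy' x hx y hy _ _ hm hm'
        ⟨m - m', by ring⟩
      exact (X.adj_zpow k _ _).2 hadj
    · intro hadj
      exact ⟨x, hx, y, hy, 0, hadj, by simpa using hh x hx, by simpa using hh y hy⟩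
  · intro x hx hx'
    apply Subtype.ext
    have h1 : (Y.aut (h x)).1 = F (h x).1 := rfl
    rw [h1, hh _ hx', hh x hx, hF]

end

/-! ### Free amalgamation. -/

/-- The free amalgam of two graphs with automorphisms over an invariant part of the second. -/
theorem exists_amalgam {V : Type u} {C : Type v} (X : AutGraph V) (Y : AutGraph C) (P : Set C)
    (hP : ∀ x, Y.aut x ∈ P ↔ x ∈ P) (c : C → V) (H : PreservesOn Y X c P) :
    ∃ (D : Type (max u v)) (Z : AutGraph D) (i : V → D) (j : C → D), PreservesOn X Z i Set.univ ∧
      PreservesOn Y Z j Set.univ ∧ ∀ p ∈ P, j p = i (c p) := by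
  classical
  have hc : ∀ p ∈ P, c (Y.aut p) = X.aut (c p) := fun p hp => H.aut p hp ((hP p).2 hp)
  -- In the amalgam a point outside `P` is joined to `V` only through `P`; this relation is
  -- compatible with the automorphisms because `P` is invariant.
  have hcross : ∀ (v : V) (x : C), (∃ p ∈ P, c p = X.aut v ∧ Y.Adj p (Y.aut x)) ↔
      ∃ p ∈ P, c p = v ∧ Y.Adj p x := by
    intro v x
    constructor
    · rintro ⟨p, hp, h1, h2⟩
      obtain ⟨q, rfl⟩ := Y.aut.surjective p
      have hq := (hP q).1 hp
      exact ⟨q, hq, X.aut.injective ((hc q hq).symm.trans h1), (Y.adj_aut _ _).1 h2⟩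
    · rintro ⟨p, hp, rfl, h2⟩
      exact ⟨Y.aut p, (hP p).2 hp, hc p hp, (Y.adj_aut _ _).2 h2⟩
  let A : V ⊕ {x // x ∉ P} → V ⊕ {x // x ∉ P} → Prop := fun a b =>
    match a, b with
    | .inl v, .inl v' => X.Adj v v'
    | .inl v, .inr x => ∃ p ∈ P, c p = v ∧ Y.Adj p x
    | .inr x, .inl v => ∃ p ∈ P, c p = v ∧ Y.Adj p x
    | .inr x, .inr y => Y.Adj x y
  let Z : AutGraph (V ⊕ {x // x ∉ P}) :=
    { Adj := A
      symm := ⟨by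
        rintro (v | x) (v' | x') h
        · exact X.symm.symm _ _ h
        · exact h
        · exact h
        · exact Y.symm.symm _ _ h⟩
      loopless := ⟨by
        rintro (v | x) h
        · exact X.loopless.irrefl _ h
        · exact Y.loopless.irrefl _ h⟩
      aut := Equiv.sumCongr X.aut (Y.aut.subtypePerm fun x => not_congr (hP x))
      adj_aut := by
        rintro (v | x) (v' | x')
        · exact X.adj_aut _ _
        · exact hcross v x'
        · exact hcross v' x
        · exact Y.adj_aut _ _ }
  let j : C → V ⊕ {x // x ∉ P} := fun x => if h : x ∈ P then .inl (c x) else .inr ⟨x, h⟩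
  have j1 : ∀ x ∈ P, j x = .inl (c x) := fun x hx => by simp [j, hx]
  have j2 : ∀ x (hx : x ∉ P), j x = .inr ⟨x, hx⟩ := fun x hx => by simp [j, hx]
  refine ⟨_, Z, Sum.inl, j, ⟨fun _ _ _ _ h => Sum.inl_injective h, fun _ _ _ _ => Iff.rfl,
    fun _ _ _ => rfl⟩, ⟨?_, ?_, ?_⟩, j1⟩
  · intro x _ y _ h
    by_cases hx : x ∈ P <;> by_cases hy : y ∈ P
    · rw [j1 x hx, j1 y hy] at h
      exact H.inj x hx y hy (Sum.inl_injective h)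
    · rw [j1 x hx, j2 y hy] at h; cases h
    · rw [j2 x hx, j1 y hy] at h; cases h
    · rw [j2 x hx, j2 y hy] at h
      exact congrArg Subtype.val (Sum.inr_injective h)
  · have hX : ∀ x ∈ P, ∀ y, (∃ p ∈ P, c p = c x ∧ Y.Adj p y) ↔ Y.Adj x y := by
      intro x hx y
      constructor
      · rintro ⟨p, hp, h1, h2⟩
        rwa [← H.inj p hp x hx h1]
      · exact fun h => ⟨x, hx, rfl, h⟩
    intro x _ y _
    by_cases hx : x ∈ P <;> by_cases hy : y ∈ P
    · rw [j1 x hx, j1 y hy]; exact H.adj x hx y hy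
    · rw [j1 x hx, j2 y hy]; exact hX x hx y
    · rw [j2 x hx, j1 y hy]; exact (hX y hy x).trans (Y.adj_comm _ _)
    · rw [j2 x hx, j2 y hy]
  · intro x _ _
    by_cases hx : x ∈ P
    · rw [j1 x hx, j1 _ ((hP x).2 hx), hc x hx]; rfl
    · rw [j2 x hx, j2 _ (fun h => hx ((hP x).1 h))]; rfl

/-! ### Extending a graph with an automorphism to a random graph. -/

/-- The extension property that characterizes random graphs. -/
def IsRandom {V : Type u} (G : SimpleGraph V) : Prop :=
  ∀ S T : Finset V, Disjoint S T → ∃ z, z ∉ S ∧ z ∉ T ∧ (∀ x ∈ S, G.Adj x z) ∧ ∀ x ∈ T, ¬G.Adj x z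

/-- Finite lists over `V` and, hereditarily, over such lists. -/
inductive Hull (V : Type u) : Type u
  | base : V → Hull V
  | nil : Hull V
  | cons : Hull V → Hull V → Hull V

namespace Hull

variable {V : Type u}

/-- Membership in a list. -/
def Mem (a : Hull V) : Hull V → Prop
  | base _ => False
  | nil => False
  | cons h t => a = h ∨ Mem a t

/-- The number of constructors. -/
def size : Hull V → ℕ
  | base _ => 0
  | nil => 0
  | cons h t => size h + size t + 1

theorem Mem.size_lt {a b : Hull V} (h : Mem a b) : a.size < b.size := by
  induction b with
  | base x => exact h.elim
  | nil => exact h.elim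
  | cons x t _ ih =>
    rcases h with rfl | h
    · simp only [size]; omega
    · have := ih h
      simp only [size]; omega

/-- The action of a map of the base. -/
def map (f : V → V) : Hull V → Hull V
  | base x => base (f x)
  | nil => nil
  | cons h t => cons (map f h) (map f t)

theorem map_map {f g : V → V} (hfg : ∀ x, f (g x) = x) (a : Hull V) : map f (map g a) = a := by
  induction a with
  | base x => simp [map, hfg]
  | nil => rfl
  | cons h t ih1 ih2 => simp [map, ih1, ih2]

/-- The permutation induced by a permutation of the base. -/
def perm (f : Equiv.Perm V) : Equiv.Perm (Hull V) :=
  ⟨map f, map f.symm, map_map f.symm_apply_apply, map_map f.apply_symm_apply⟩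

theorem mem_perm (f : Equiv.Perm V) (a b : Hull V) : Mem (perm f a) (perm f b) ↔ Mem a b := by
  induction b with
  | base x => exact Iff.rfl
  | nil => exact Iff.rfl
  | cons h t _ ih => exact or_congr (perm f).injective.eq_iff ih

/-- The list with the given members. -/
def ofList (l : List (Hull V)) : Hull V := l.foldr cons nil

theorem mem_ofList (a : Hull V) (l : List (Hull V)) : Mem a (ofList l) ↔ a ∈ l := by
  induction l with
  | nil => simp [ofList, Mem]
  | cons h t ih =>
    rw [List.mem_cons, ← ih]
    exact Iff.rfl

/-- Adjacency: that of the base, and membership. -/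
def Adj (G : SimpleGraph V) (a b : Hull V) : Prop :=
  (∃ x y, a = base x ∧ b = base y ∧ G.Adj x y) ∨ Mem a b ∨ Mem b a

/-- The hull of a graph with an automorphism. -/
def autGraph (X : AutGraph V) : AutGraph (Hull V) where
  Adj := Adj X.toSimpleGraph
  symm := ⟨by
    rintro a b (⟨x, y, rfl, rfl, h⟩ | h | h)
    · exact .inl ⟨y, x, rfl, rfl, h.symm⟩
    · exact .inr (.inr h)
    · exact .inr (.inl h)⟩
  loopless := ⟨by
    rintro a (⟨x, y, rfl, h, h'⟩ | h | h)
    · cases h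
      exact X.loopless.irrefl _ h'
    · exact h.size_lt.ne rfl
    · exact h.size_lt.ne rfl⟩
  aut := perm X.aut
  adj_aut := by
    intro a b
    refine or_congr ⟨?_, ?_⟩ (or_congr (mem_perm _ _ _) (mem_perm _ _ _))
    · rintro ⟨x, y, ha, hb, h⟩
      refine ⟨X.aut.symm x, X.aut.symm y, ?_, ?_, (X.adj_aut_symm _ _).2 h⟩
      · rw [← (perm X.aut).symm_apply_apply a, ha]; rfl
      · rw [← (perm X.aut).symm_apply_apply b, hb]; rfl
    · rintro ⟨x, y, rfl, rfl, h⟩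
      exact ⟨X.aut x, X.aut y, rfl, rfl, (X.adj_aut _ _).2 h⟩

theorem preservesOn_base (X : AutGraph V) : PreservesOn X (autGraph X) base Set.univ := by
  refine ⟨fun x _ y _ h => by cases h; rfl, fun x _ y _ => ⟨?_, ?_⟩, fun _ _ _ => rfl⟩
  · rintro (⟨x, y, h1, h2, h⟩ | h | h)
    · cases h1; cases h2; exact h
    · exact h.elim
    · exact h.elim
  · exact fun h => .inl ⟨x, y, rfl, rfl, h⟩

/-- The new vertex `z` lists `S` and a tag `w`, which itself lists `S` and `T`. The tag makes `z`
larger than every element of `S` and `T`, so `z` is neither one of them nor a member of one; and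
`w`, being larger as well, is not in `T`. Lists are convenient because a permutation of the base
acts on them and respects membership, so the automorphism extends along with the graph. -/
theorem isRandom_autGraph (X : AutGraph V) : IsRandom (autGraph X).toSimpleGraph := by
  intro S T hST
  let w := ofList (S.toList ++ T.toList)
  let z := ofList (w :: S.toList)
  have hwz : Mem w z := (mem_ofList _ _).2 (by simp)
  have hw : ∀ x, Mem x w ↔ x ∈ S ∨ x ∈ T := fun x => by simp [w, mem_ofList]
  have hz : ∀ x, Mem x z ↔ x = w ∨ x ∈ S := fun x => by simp [z, mem_ofList]
  have hzw : ¬Mem z w := fun h => by have := h.size_lt; have := hwz.size_lt; omega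
  refine ⟨z, fun h => hzw ((hw z).2 (.inl h)), fun h => hzw ((hw z).2 (.inr h)),
    fun x hx => .inr (.inl ((hz x).2 (.inr hx))), fun x hx => ?_⟩
  have hxw := ((hw x).2 (.inr hx)).size_lt
  rintro (⟨x, y, _, h2, _⟩ | h | h)
  · simp [z, ofList] at h2
  · rcases (hz x).1 h with rfl | h
    · exact hxw.ne rfl
    · exact Finset.disjoint_left.1 hST h hx
  · have := h.size_lt
    have := hwz.size_lt
    omega

end Hull

/-! ### Partial isomorphisms and back-and-forth. -/

/-- Partial isomorphisms of graphs, as relations. -/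
def IsPartialIso {M : Type u} {N : Type v} (G : SimpleGraph M) (H : SimpleGraph N)
    (R : Set (M × N)) : Prop :=
  ∀ p ∈ R, ∀ q ∈ R, (p.1 = q.1 ↔ p.2 = q.2) ∧ (G.Adj p.1 q.1 ↔ H.Adj p.2 q.2)

section

variable {M : Type u} {N : Type v} {G : SimpleGraph M} {H : SimpleGraph N}

theorem IsPartialIso.swap {R : Set (M × N)} (hR : IsPartialIso G H R) :
    IsPartialIso H G (Prod.swap ⁻¹' R) :=
  fun _ hp _ hq => ⟨(hR _ hp _ hq).1.symm, (hR _ hp _ hq).2.symm⟩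

/-- The extension property is applied to the partners of the neighbours and of the nonneighbours of
`x`, which are disjoint since `R` is a partial isomorphism. -/
theorem IsPartialIso.exists_insert (hH : IsRandom H) {R : Set (M × N)} (hR : IsPartialIso G H R)
    (hf : R.Finite) (x : M) : ∃ y, IsPartialIso G H (insert (x, y) R) := by
  classical
  by_cases hx : ∃ y, (x, y) ∈ R
  · obtain ⟨y, hy⟩ := hx
    exact ⟨y, by rwa [Set.insert_eq_of_mem hy]⟩
  push Not at hx
  have hS : (Prod.snd '' {p ∈ R | G.Adj p.1 x}).Finite := (hf.subset (Set.sep_subset _ _)).image _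
  have hT : (Prod.snd '' {p ∈ R | ¬G.Adj p.1 x}).Finite := (hf.subset (Set.sep_subset _ _)).image _
  obtain ⟨z, hzS, hzT, hS', hT'⟩ := hH hS.toFinset hT.toFinset (by
    rw [Finset.disjoint_left]
    intro y h1 h2
    rw [Set.Finite.mem_toFinset] at h1 h2
    obtain ⟨p, ⟨hp, hpx⟩, rfl⟩ := h1
    obtain ⟨q, ⟨hq, hqx⟩, e⟩ := h2
    rw [(hR _ hq _ hp).1.2 e] at hqx
    exact hqx hpx)
  simp only [Set.Finite.mem_toFinset] at hzS hzT hS' hT'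
  have key : ∀ p ∈ R, p.1 ≠ x ∧ p.2 ≠ z ∧ (G.Adj p.1 x ↔ H.Adj p.2 z) := by
    intro p hp
    refine ⟨fun e => hx p.2 (by rw [← e]; exact hp), ?_, ?_⟩
    · rintro rfl
      by_cases h : G.Adj p.1 x
      · exact hzS ⟨p, ⟨hp, h⟩, rfl⟩
      · exact hzT ⟨p, ⟨hp, h⟩, rfl⟩
    · by_cases h : G.Adj p.1 x
      · exact iff_of_true h (hS' _ ⟨p, ⟨hp, h⟩, rfl⟩)
      · exact iff_of_false h (hT' _ ⟨p, ⟨hp, h⟩, rfl⟩)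
  refine ⟨z, ?_⟩
  rintro p (rfl | hp) q (rfl | hq)
  · simp
  · obtain ⟨h1, h2, h3⟩ := key q hq
    exact ⟨iff_of_false h1.symm h2.symm, by rw [G.adj_comm, H.adj_comm]; exact h3⟩
  · obtain ⟨h1, h2, h3⟩ := key p hp
    exact ⟨iff_of_false h1 h2, h3⟩
  · exact hR p hp q hq

theorem IsPartialIso.exists_finite_superset (hH : IsRandom H) {R : Set (M × N)}
    (hR : IsPartialIso G H R) (hf : R.Finite) (Q : Finset M) :
    ∃ R', R ⊆ R' ∧ IsPartialIso G H R' ∧ ∀ x ∈ Q, ∃ y, (x, y) ∈ R' := by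
  classical
  suffices ∃ R', R ⊆ R' ∧ R'.Finite ∧ IsPartialIso G H R' ∧ ∀ x ∈ Q, ∃ y, (x, y) ∈ R' by
    obtain ⟨R', h1, _, h2, h3⟩ := this
    exact ⟨R', h1, h2, h3⟩
  induction Q using Finset.induction_on with
  | empty => exact ⟨R, subset_rfl, hf, hR, by simp⟩
  | insert x Q _ ih =>
    obtain ⟨R', h1, h2, h3, h4⟩ := ih
    obtain ⟨y, hy⟩ := h3.exists_insert hH h2 x
    refine ⟨insert (x, y) R', h1.trans (Set.subset_insert _ _), h2.insert _, hy, ?_⟩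
    intro x' hx'
    rcases Finset.mem_insert.1 hx' with rfl | hx'
    · exact ⟨y, Set.mem_insert _ _⟩
    · obtain ⟨y', h⟩ := h4 x' hx'
      exact ⟨y', Set.mem_insert_of_mem _ h⟩

/-- The union of a chain of partial bijections that extend back and forth is a bijection. -/
theorem exists_equiv_of_backAndForth [Countable M] [Countable N] (F : Set (Set (M × N)))
    (hF : ∀ R ∈ F, ∀ p ∈ R, ∀ q ∈ R, (p.1 = q.1 ↔ p.2 = q.2))
    (forth : ∀ R ∈ F, ∀ x, ∃ R' ∈ F, R ⊆ R' ∧ ∃ y, (x, y) ∈ R')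
    (back : ∀ R ∈ F, ∀ y, ∃ R' ∈ F, R ⊆ R' ∧ ∃ x, (x, y) ∈ R') {R₀ : Set (M × N)} (hR₀ : R₀ ∈ F) :
    ∃ e : M ≃ N, (∀ p ∈ R₀, e p.1 = p.2) ∧
      ∀ x y, ∃ R ∈ F, (x, e x) ∈ R ∧ (y, e y) ∈ R := by
  -- One enumeration of `M ⊕ N` serves both directions: each cofinal set asks for a point in the
  -- domain or in the range, and the ideal meets them all.
  let _ : Encodable (M ⊕ N) := Encodable.ofCountable _
  let 𝒟 : M ⊕ N → Order.Cofinal F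
    | .inl x => ⟨{R | ∃ y, (x, y) ∈ R.1}, fun R => by
        obtain ⟨R', h1, h2, h3⟩ := forth R.1 R.2 x
        exact ⟨⟨R', h1⟩, h3, h2⟩⟩
    | .inr y => ⟨{R | ∃ x, (x, y) ∈ R.1}, fun R => by
        obtain ⟨R', h1, h2, h3⟩ := back R.1 R.2 y
        exact ⟨⟨R', h1⟩, h3, h2⟩⟩
  let I := Order.idealOfCofinals (⟨R₀, hR₀⟩ : F) 𝒟
  let E : M → N → Prop := fun x y => ∃ R ∈ I, (x, y) ∈ R.1
  have hE : ∀ {x y x' y'}, E x y → E x' y' → ∃ R ∈ F, (x, y) ∈ R ∧ (x', y') ∈ R := by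
    rintro x y x' y' ⟨R, hR, h⟩ ⟨R', hR', h'⟩
    obtain ⟨S, _, h1, h2⟩ := I.directed R hR R' hR'
    exact ⟨S.1, S.2, h1 h, h2 h'⟩
  have hf : ∀ x, ∃ y, E x y := fun x => by
    obtain ⟨R, ⟨y, hy⟩, hR⟩ := Order.cofinal_meets_idealOfCofinals (⟨R₀, hR₀⟩ : F) 𝒟 (.inl x)
    exact ⟨y, R, hR, hy⟩
  have hg : ∀ y, ∃ x, E x y := fun y => by
    obtain ⟨R, ⟨x, hx⟩, hR⟩ := Order.cofinal_meets_idealOfCofinals (⟨R₀, hR₀⟩ : F) 𝒟 (.inr y)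
    exact ⟨x, R, hR, hx⟩
  choose f hf using hf
  choose g hg using hg
  refine ⟨⟨f, g, fun x => ?_, fun y => ?_⟩, fun p hp => ?_, fun x y => hE (hf x) (hf y)⟩
  · obtain ⟨R, hR, h1, h2⟩ := hE (hg (f x)) (hf x)
    exact (hF R hR _ h1 _ h2).2 rfl
  · obtain ⟨R, hR, h1, h2⟩ := hE (hf (g y)) (hg y)
    exact (hF R hR _ h1 _ h2).1 rfl
  · obtain ⟨R, hR, h1, h2⟩ := hE (hf p.1) ⟨⟨R₀, hR₀⟩, Order.mem_idealOfCofinals _ _, hp⟩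
    exact (hF R hR _ h1 _ h2).1 rfl

/-- Finite partial isomorphisms between countable random graphs extend to isomorphisms. -/
theorem IsPartialIso.exists_equiv [Countable M] [Countable N] (hG : IsRandom G) (hH : IsRandom H)
    {R : Set (M × N)} (hR : IsPartialIso G H R) (hf : R.Finite) :
    ∃ e : M ≃ N, (∀ p ∈ R, e p.1 = p.2) ∧ ∀ x y, H.Adj (e x) (e y) ↔ G.Adj x y := by
  obtain ⟨e, h1, h2⟩ := exists_equiv_of_backAndForth {R | IsPartialIso G H R ∧ R.Finite}
    (fun R hR p hp q hq => (hR.1 p hp q hq).1)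
    (fun R hR x => by
      obtain ⟨y, hy⟩ := hR.1.exists_insert hH hR.2 x
      exact ⟨_, ⟨hy, hR.2.insert _⟩, Set.subset_insert _ _, y, Set.mem_insert _ _⟩)
    (fun R hR y => by
      have hfin : (Prod.swap ⁻¹' R).Finite := hR.2.preimage Prod.swap_injective.injOn
      obtain ⟨x, hx⟩ := hR.1.swap.exists_insert hG hfin y
      have := hx.swap
      refine ⟨insert (x, y) R, ⟨?_, hR.2.insert _⟩, Set.subset_insert _ _, x, Set.mem_insert _ _⟩
      convert this using 1
      ext ⟨a, b⟩
      simp [and_comm])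
    ⟨hR, hf⟩
  refine ⟨e, h1, fun x y => ?_⟩
  obtain ⟨R', hR', hx, hy⟩ := h2 x y
  exact (hR'.1 _ hx _ hy).2.symm

end

/-! ### Generic automorphisms: extension, absorption, conjugacy. -/

section

variable {V : Type u} {V' : Type v} {X : AutGraph V} {Y : AutGraph V'}

theorem PreservesOn.aut_mem_image {h : V → V'} {A : Set V} (H : PreservesOn X Y h A)
    (hA : ∀ x, X.aut x ∈ A ↔ x ∈ A) (y : V') : Y.aut y ∈ h '' A ↔ y ∈ h '' A := by
  constructor
  · rintro ⟨a, ha, e⟩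
    obtain ⟨b, rfl⟩ := X.aut.surjective a
    exact ⟨b, (hA b).1 ha, Y.aut.injective ((H.aut b ((hA b).1 ha) ha).symm.trans e)⟩
  · rintro ⟨a, ha, rfl⟩
    exact ⟨X.aut a, (hA a).2 ha, H.aut a ha ((hA a).2 ha)⟩

theorem PreservesOn.exists_inverse [Nonempty V] {h : V → V'} {A : Set V}
    (H : PreservesOn X Y h A) (hA : ∀ x, X.aut x ∈ A ↔ x ∈ A) :
    ∃ c : V' → V, PreservesOn Y X c (h '' A) ∧ ∀ a ∈ A, c (h a) = a := by
  have hc : ∀ a ∈ A, Function.invFunOn h A (h a) = a := fun a ha =>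
    Function.invFunOn_apply_eq (f := h) ha |> H.inj _ (Function.invFunOn_mem ⟨a, ha, rfl⟩) _ ha
  refine ⟨Function.invFunOn h A, ⟨?_, ?_, ?_⟩, hc⟩
  · rintro _ ⟨a, ha, rfl⟩ _ ⟨b, hb, rfl⟩ e
    rw [hc a ha, hc b hb] at e
    rw [e]
  · rintro _ ⟨a, ha, rfl⟩ _ ⟨b, hb, rfl⟩
    rw [hc a ha, hc b hb]
    exact (H.adj a ha b hb).symm
  · rintro _ ⟨a, ha, rfl⟩ _
    have ha' := (hA a).2 ha
    rw [← H.aut a ha ha', hc a ha, hc _ ha']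

end

theorem IsRandom.nonempty {V : Type u} {G : SimpleGraph V} (h : IsRandom G) : Nonempty V :=
  let ⟨z, _⟩ := h ∅ ∅ (by simp)
  ⟨z⟩

section

variable {N : Type u}

/-- If the action of an automorphism of the countable random graph on a finite set `F` is realized
in a finite graph with an automorphism, then the latter embeds over `F` in the random graph, with
an automorphism that has the same action on `F`. -/
theorem exists_aut_extending [Countable N] {X : AutGraph N} (hX : IsRandom X.toSimpleGraph) {D : Type v}
    [Finite D] {Y : AutGraph D} (F : Finset N) {i : N → D}
    (hi : PreservesOn X Y i (F ∪ X.aut '' F)) :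
    ∃ X' : AutGraph N, X'.toSimpleGraph = X.toSimpleGraph ∧ (∀ x ∈ F, X'.aut x = X.aut x) ∧
      ∃ e : D → N, PreservesOn Y X' e Set.univ ∧ ∀ x ∈ F, e (i x) = x := by
  have := Fintype.ofFinite D
  let W : Set N := F ∪ X.aut '' F
  have hW : W.Finite := F.finite_toSet.union (F.finite_toSet.image _)
  have h0 : IsPartialIso Y.toSimpleGraph X.toSimpleGraph ((fun x => (i x, x)) '' W) := by
    rintro _ ⟨x, hx, rfl⟩ _ ⟨y, hy, rfl⟩
    exact ⟨⟨hi.inj x hx y hy, fun h => congrArg i h⟩, hi.adj x hx y hy⟩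
  obtain ⟨R, hR0, hR, hR'⟩ := h0.exists_finite_superset hX (hW.image _) Finset.univ
  choose e he using fun d => hR' d (Finset.mem_univ d)
  have hei : ∀ x ∈ W, e (i x) = x := fun x hx =>
    (hR _ (he (i x)) _ (hR0 ⟨x, hx, rfl⟩)).1.1 rfl
  -- The automorphism of `Y`, read on the copy of `D` in `N`, is a finite partial automorphism and
  -- extends to `N` by homogeneity. It agrees with `X.aut` on `F` because `i` respects `X.aut`
  -- there.
  have h1 : IsPartialIso X.toSimpleGraph X.toSimpleGraph
      (Set.range fun d => (e d, e (Y.aut d))) := by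
    rintro _ ⟨x, rfl⟩ _ ⟨y, rfl⟩
    have ha := hR _ (he x) _ (he y)
    have hb := hR _ (he (Y.aut x)) _ (he (Y.aut y))
    refine ⟨ha.1.symm.trans (Iff.trans ?_ hb.1), ha.2.symm.trans (Iff.trans ?_ hb.2)⟩
    · exact Y.aut.injective.eq_iff.symm
    · exact (Y.adj_aut x y).symm
  obtain ⟨φ, hφ, hφ'⟩ := h1.exists_equiv hX hX (Set.finite_range _)
  have hφe : ∀ d, φ (e d) = e (Y.aut d) := fun d => hφ _ ⟨d, rfl⟩
  refine ⟨{ X.toSimpleGraph with aut := φ, adj_aut := hφ' }, rfl, fun x hx => ?_, e,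
    ⟨fun x _ y _ h => (hR _ (he x) _ (he y)).1.2 h,
      fun x _ y _ => (hR _ (he x) _ (he y)).2.symm, fun x _ _ => (hφe x).symm⟩,
    fun x hx => hei x (.inl hx)⟩
  have hx1 : x ∈ W := .inl hx
  have hx2 : X.aut x ∈ W := .inr ⟨x, hx, rfl⟩
  change φ x = X.aut x
  calc φ x = φ (e (i x)) := by rw [hei x hx1]
    _ = e (i (X.aut x)) := by rw [hφe, ← hi.aut x hx1 hx2]
    _ = X.aut x := hei _ hx2

/-- Generic automorphisms: all orbits are finite, and finite graphs with an automorphism embed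
over common finite parts. -/
structure IsGenericAut {N : Type u} (X : AutGraph N) : Prop where
  finite_orbit : ∀ x, ∃ k : ℕ, 0 < k ∧ (X.aut ^ k) x = x
  exists_extension_fin : ∀ (n : ℕ) (Y : AutGraph (Fin n)) (P : Set (Fin n)) (c : Fin n → N),
    (∀ x, Y.aut x ∈ P ↔ x ∈ P) → PreservesOn Y X c P →
      ∃ e : Fin n → N, PreservesOn Y X e Set.univ ∧ ∀ p ∈ P, e p = c p

/-- The definition mentions only the types `Fin n`, which keeps its conditions countable in number
when `N` is countable; an enumeration of `C` removes this restriction. -/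
theorem IsGenericAut.exists_extension {X : AutGraph N} (hX : IsGenericAut X) {C : Type v} [Finite C]
    {Y : AutGraph C} {P : Set C} (hP : ∀ x, Y.aut x ∈ P ↔ x ∈ P) {c : C → N}
    (hc : PreservesOn Y X c P) : ∃ e : C → N, PreservesOn Y X e Set.univ ∧ ∀ p ∈ P, e p = c p := by
  obtain ⟨n, ⟨ε⟩⟩ := Finite.exists_equiv_fin C
  let Y' : AutGraph (Fin n) :=
    { Adj := fun a b => Y.Adj (ε.symm a) (ε.symm b)
      symm := ⟨fun _ _ h => Y.symm.symm _ _ h⟩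
      loopless := ⟨fun _ h => Y.loopless.irrefl _ h⟩
      aut := ε.permCongr Y.aut
      adj_aut := fun x y => by simp [Equiv.permCongr_apply, Y.adj_aut] }
  have h1 : PreservesOn Y' Y ε.symm Set.univ :=
    ⟨fun x _ y _ h => ε.symm.injective h, fun _ _ _ _ => Iff.rfl,
      fun x _ _ => by simp [Y', Equiv.permCongr_apply]⟩
  have h2 : PreservesOn Y Y' ε Set.univ :=
    ⟨fun x _ y _ h => ε.injective h, fun x _ y _ => by simp [Y'],
      fun x _ _ => by simp [Y', Equiv.permCongr_apply]⟩
  obtain ⟨e, he, he'⟩ := hX.exists_extension_fin n Y' (ε.symm ⁻¹' P) (c ∘ ε.symm)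
    (fun x => by simp [Y', Equiv.permCongr_apply, hP])
    (hc.comp (h1.mono (Set.subset_univ _)) (fun x hx => hx))
  exact ⟨e ∘ ε, he.comp h2 (Set.mapsTo_univ _ _), fun p hp => by
    simpa using he' (ε p) (by simpa using hp)⟩

theorem IsGenericAut.exists_finite_invariant {X : AutGraph N} (hX : IsGenericAut X) {W : Set N}
    (hW : W.Finite) : ∃ A : Set N, W ⊆ A ∧ A.Finite ∧ ∀ x, X.aut x ∈ A ↔ x ∈ A := by
  refine ⟨⋃ x ∈ W, {y | X.aut.SameCycle x y}, fun x hx => Set.mem_biUnion hx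
    (Equiv.Perm.SameCycle.refl _ _), hW.biUnion fun x _ => ?_, fun y => ?_⟩
  · obtain ⟨p, hp, h⟩ := hX.finite_orbit x
    refine (Set.finite_range fun k : Fin p => (X.aut ^ (k : ℕ)) x).subset ?_
    rintro y ⟨k, rfl⟩
    have hp' : (0 : ℤ) < p := by exact_mod_cast hp
    have h1 := Int.emod_nonneg k hp'.ne'
    have h2 := Int.emod_lt_of_pos k hp'
    refine ⟨⟨(k % p).toNat, by omega⟩, ?_⟩
    have h3 : (X.aut ^ (p * (k / p))) x = x := by
      rw [zpow_mul, zpow_natCast]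
      exact Equiv.Perm.zpow_apply_eq_self_of_apply_eq_self h _
    conv_rhs => rw [← Int.emod_add_mul_ediv k p, zpow_add, Equiv.Perm.mul_apply, h3]
    simp only
    rw [← zpow_natCast, Int.toNat_of_nonneg h1]
  · simp [Equiv.Perm.sameCycle_apply_right]

/-- A generic automorphism realizes over a finite invariant set the finite parts of every graph
with an automorphism. -/
theorem IsGenericAut.absorbs {X : AutGraph N} (hX : IsGenericAut X) {A : Set N} (hA : A.Finite)
    (hA' : ∀ x, X.aut x ∈ A ↔ x ∈ A) [Nonempty N] {U : Type v} {Z : AutGraph U} {j : N → U}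
    (hj : PreservesOn X Z j A) {W : Set U} (hW : W.Finite) :
    ∃ h : U → N, PreservesOn Z X h W ∧ ∀ a ∈ A, h (j a) = a := by
  have : Nonempty U := ‹Nonempty N›.map j
  have hfin : (W ∪ j '' A).Finite := hW.union (hA.image j)
  -- `Z` may be infinite, but a finite model of its part on `W` and on the copy of `A` suffices. In
  -- that model the copy of `A` is invariant, and `c` maps it back to `A`.
  obtain ⟨C, _, Y, k, hk⟩ := exists_finite_preservesOn Z hfin.toFinset
  rw [Set.Finite.coe_toFinset] at hk
  have hkj : PreservesOn X Y (k ∘ j) A := hk.comp hj fun a ha => .inr ⟨a, ha, rfl⟩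
  obtain ⟨c, hc, hc'⟩ := hkj.exists_inverse hA'
  obtain ⟨e, he, he'⟩ := hX.exists_extension (hkj.aut_mem_image hA') hc
  exact ⟨e ∘ k, he.comp (hk.mono Set.subset_union_left) (Set.mapsTo_univ _ _), fun a ha =>
    (he' _ ⟨a, ha, rfl⟩).trans (hc' a ha)⟩

/-- Finite partial isomorphisms between graphs with an automorphism, with invariant domain and
range. -/
def invariantPartialIsos {N : Type u} {N' : Type v} (X : AutGraph N) (Y : AutGraph N') :
    Set (Set (N × N')) :=
  {R | R.Finite ∧ IsPartialIso X.toSimpleGraph Y.toSimpleGraph R ∧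
    ∀ x y, (X.aut x, Y.aut y) ∈ R ↔ (x, y) ∈ R}

theorem swap_mem_invariantPartialIsos {N' : Type v} {X : AutGraph N} {Y : AutGraph N'}
    {R : Set (N × N')} (hR : R ∈ invariantPartialIsos X Y) :
    Prod.swap ⁻¹' R ∈ invariantPartialIsos Y X :=
  ⟨hR.1.preimage Prod.swap_injective.injOn, hR.2.1.swap, fun x y => hR.2.2 y x⟩

theorem PreservesOn.mem_invariantPartialIsos {N' : Type v} {X : AutGraph N} {Y : AutGraph N'}
    {h : N → N'} {A : Set N} (H : PreservesOn X Y h A) (hA : A.Finite)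
    (hA' : ∀ x, X.aut x ∈ A ↔ x ∈ A) :
    (fun x => (x, h x)) '' A ∈ invariantPartialIsos X Y := by
  refine ⟨hA.image _, ?_, fun x y => ⟨?_, ?_⟩⟩
  · rintro _ ⟨x, hx, rfl⟩ _ ⟨y, hy, rfl⟩
    exact ⟨⟨fun e => congrArg h e, H.inj x hx y hy⟩, (H.adj x hx y hy).symm⟩
  · rintro ⟨a, ha, e⟩
    rw [Prod.mk.injEq] at e
    obtain ⟨rfl, e⟩ := e
    have hx := (hA' x).1 ha
    rw [H.aut x hx ha] at e
    exact ⟨x, hx, Prod.ext rfl (Y.aut.injective e)⟩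
  · rintro ⟨a, ha, e⟩
    rw [Prod.mk.injEq] at e
    obtain ⟨rfl, rfl⟩ := e
    exact ⟨X.aut a, (hA' a).2 ha, Prod.ext rfl (H.aut a ha ((hA' a).2 ha))⟩

/-- Read backwards, `R` embeds its range `B` into `N`. So `Y` absorbs over `B` a finite invariant
set of `N` that contains `x` and the domain of `R`, and the graph of the absorbing map on this set
extends `R`. -/
theorem IsGenericAut.forth {N' : Type v} [Nonempty N] [Nonempty N'] {X : AutGraph N}
    {Y : AutGraph N'} (hX : IsGenericAut X) (hY : IsGenericAut Y) {R : Set (N × N')}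
    (hR : R ∈ invariantPartialIsos X Y) (x : N) :
    ∃ R' ∈ invariantPartialIsos X Y, R ⊆ R' ∧ ∃ y, (x, y) ∈ R' := by
  obtain ⟨hfin, hiso, hinv⟩ := hR
  obtain ⟨A, hA, hAfin, hA'⟩ := hX.exists_finite_invariant
    ((hfin.image Prod.fst).insert x)
  let B : Set N' := Prod.snd '' R
  have hj : ∀ y : N', ∃ x : N, y ∈ B → (x, y) ∈ R := by
    intro y
    by_cases hy : y ∈ B
    · obtain ⟨p, hp, rfl⟩ := hy
      exact ⟨p.1, fun _ => hp⟩
    · exact ⟨Classical.arbitrary N, fun h => absurd h hy⟩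
  choose j hj using hj
  have hB : ∀ y, Y.aut y ∈ B ↔ y ∈ B := by
    intro y
    constructor
    · rintro ⟨⟨a, b⟩, hp, rfl⟩
      obtain ⟨a, rfl⟩ := X.aut.surjective a
      exact ⟨(a, y), (hinv _ _).1 hp, rfl⟩
    · rintro ⟨⟨a, b⟩, hp, rfl⟩
      exact ⟨(X.aut a, Y.aut b), (hinv _ _).2 hp, rfl⟩
  have hjB : PreservesOn Y X j B := by
    refine ⟨fun y hy y' hy' e => (hiso _ (hj y hy) _ (hj y' hy')).1.1 e,
      fun y hy y' hy' => (hiso _ (hj y hy) _ (hj y' hy')).2, fun y hy hy' => ?_⟩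
    exact (hiso _ (hj _ hy') _ ((hinv _ _).2 (hj y hy))).1.2 rfl
  obtain ⟨h, hh, hh'⟩ := hY.absorbs (hfin.image _) hB hjB hAfin
  refine ⟨_, hh.mem_invariantPartialIsos hAfin hA', ?_, h x, x, hA (Set.mem_insert _ _), rfl⟩
  rintro ⟨a, b⟩ hp
  have hb : b ∈ B := ⟨_, hp, rfl⟩
  have hab : j b = a := (hiso _ (hj b hb) _ hp).1.2 rfl
  exact ⟨a, hA (Set.mem_insert_of_mem _ ⟨_, hp, rfl⟩), Prod.ext rfl (hab ▸ hh' b hb)⟩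

/-- Any two generic automorphisms are conjugate. -/
theorem IsGenericAut.exists_equiv {N' : Type v} [Countable N] [Countable N'] [Nonempty N] [Nonempty N']
    {X : AutGraph N} {Y : AutGraph N'} (hX : IsGenericAut X) (hY : IsGenericAut Y) :
    ∃ e : N ≃ N', (∀ x y, Y.Adj (e x) (e y) ↔ X.Adj x y) ∧ ∀ x, e (X.aut x) = Y.aut (e x) := by
  obtain ⟨e, -, he⟩ := exists_equiv_of_backAndForth (invariantPartialIsos X Y)
    (fun R hR p hp q hq => (hR.2.1 p hp q hq).1)
    (fun R hR x => hX.forth hY hR x)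
    (fun R hR y => by
      obtain ⟨R', h1, h2, x, h3⟩ := hY.forth hX (swap_mem_invariantPartialIsos hR) y
      exact ⟨_, swap_mem_invariantPartialIsos h1, fun p hp => h2 hp, x, h3⟩)
    (R₀ := ∅) ⟨Set.finite_empty, by rintro p ⟨⟩, fun x y => Iff.rfl⟩
  refine ⟨e, fun x y => ?_, fun x => ?_⟩
  · obtain ⟨R, hR, hx, hy⟩ := he x y
    exact (hR.2.1 _ hx _ hy).2.symm
  -- By invariance `R` also pairs `X.aut x` with `Y.aut (e x)`, and `R` is single-valued.
  · obtain ⟨R, hR, hx, hy⟩ := he x (X.aut x)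
    exact (hR.2.1 _ hy _ ((hR.2.2 _ _).2 hx)).1.1 rfl

/-- This gives density of the finiteness of orbits: once `X'` carries a copy of a finite `Y` through
`F`, the order of `Y.aut` is a period of every point of `F`. -/
theorem exists_aut_finite_orbits [Countable N] {X : AutGraph N} (hX : IsRandom X.toSimpleGraph) (F : Finset N) :
    ∃ X' : AutGraph N, X'.toSimpleGraph = X.toSimpleGraph ∧ (∀ x ∈ F, X'.aut x = X.aut x) ∧
      ∀ x ∈ F, ∃ k : ℕ, 0 < k ∧ (X'.aut ^ k) x = x := by
  have := hX.nonempty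
  have hW : ((F : Set N) ∪ X.aut '' F).Finite := F.finite_toSet.union (F.finite_toSet.image _)
  obtain ⟨D, _, Y, i, hi⟩ := exists_finite_preservesOn X hW.toFinset
  rw [Set.Finite.coe_toFinset] at hi
  obtain ⟨X', h1, h2, e, he, he'⟩ := exists_aut_extending hX F hi
  refine ⟨X', h1, h2, fun x hx => ⟨orderOf Y.aut, orderOf_pos _, ?_⟩⟩
  have key : ∀ (k : ℕ) (d : D), (X'.aut ^ k) (e d) = e ((Y.aut ^ k) d) := by
    intro k d
    induction k with
    | zero => rfl
    | succ k ih =>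
      rw [pow_succ', pow_succ', Equiv.Perm.mul_apply, ih, Equiv.Perm.mul_apply]
      exact (he.aut _ (Set.mem_univ _) (Set.mem_univ _)).symm
  rw [← he' x hx, key, pow_orderOf_eq_one]
  rfl

/-- This gives density of the extension conditions. The problem is solved in the free amalgam, a
finite part of which is put back into `N`; `F` is enlarged by the image of `P` so that the embedding
still extends `c`. -/
theorem exists_aut_extension [Countable N] {X : AutGraph N} (hX : IsRandom X.toSimpleGraph) (F : Finset N)
    {C : Type} [Finite C] {Y : AutGraph C} {P : Set C} (hP : ∀ x, Y.aut x ∈ P ↔ x ∈ P) {c : C → N}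
    (hc : PreservesOn Y X c P) :
    ∃ X' : AutGraph N, X'.toSimpleGraph = X.toSimpleGraph ∧ (∀ x ∈ F, X'.aut x = X.aut x) ∧
      ∃ e : C → N, PreservesOn Y X' e Set.univ ∧ ∀ p ∈ P, e p = c p := by
  classical
  have := hX.nonempty
  obtain ⟨E, Z, i, j, hi, hj, hij⟩ := exists_amalgam X Y P hP c hc
  have : Nonempty E := this.map i
  have hcP : (c '' P).Finite := P.toFinite.image c
  let F' : Finset N := F ∪ hcP.toFinset
  have hcF' : ∀ p ∈ P, c p ∈ F' := fun p hp =>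
    Finset.mem_union_right _ (hcP.mem_toFinset.2 ⟨p, hp, rfl⟩)
  have hW : (i '' (F' ∪ X.aut '' F') ∪ Set.range j).Finite :=
    ((F'.finite_toSet.union (F'.finite_toSet.image _)).image _).union (Set.finite_range j)
  obtain ⟨D, _, Q, k, hk⟩ := exists_finite_preservesOn Z hW.toFinset
  rw [Set.Finite.coe_toFinset] at hk
  obtain ⟨X', h1, h2, e, he, he'⟩ := exists_aut_extending hX F' (i := k ∘ i)
    (hk.comp (hi.mono (Set.subset_univ _)) fun x hx => .inl ⟨x, hx, rfl⟩)
  refine ⟨X', h1, fun x hx => h2 x (Finset.mem_union_left _ hx), e ∘ k ∘ j,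
    he.comp (hk.comp hj fun x _ => .inr ⟨x, rfl⟩) (Set.mapsTo_univ _ _), fun p hp => ?_⟩
  simpa [hij p hp] using he' (c p) (hcF' p hp)

end

/-! ### Models of the theory as random graphs with an automorphism. -/

section
variable {V : Type u}

/-- The interpretation of `f`. -/
def fwd (σ : autLang.Structure V) (x : V) : V := σ.funMap AutFunctions.f ![x]

/-- The interpretation of `f⁻¹`. -/
def bwd (σ : autLang.Structure V) (x : V) : V := σ.funMap AutFunctions.fInv ![x]

theorem autLang_structure_ext {s t : autLang.Structure V} (h1 : ∀ x, fwd s x = fwd t x)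
    (h2 : ∀ x, bwd s x = bwd t x) : s = t := by
  ext n s x
  · cases s <;> rw [show x = ![x 0] from List.ofFn_inj.1 rfl]
    · exact h1 _
    · exact h2 _
  · exact s.elim

variable [Language.graph.Structure V]

theorem models_iff (σ : autLang.Structure V) : Models σ randomGraphAut ↔
    V ⊨ randomGraph ∧ (∀ x : V, fwd σ (bwd σ x) = x ∧ bwd σ (fwd σ x) = x) ∧
      ∀ x y : V, RelMap adj ![x, y] ↔ RelMap adj ![fwd σ x, fwd σ y] := by
  unfold Models randomGraphAut
  let _ := σ
  rw [Theory.model_union_iff, LHom.onTheory_model, Theory.model_singleton_iff]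
  refine and_congr_right fun _ => ?_
  simp only [autAxiom, Sentence.Realize, Formula.Realize, BoundedFormula.realize_inf,
    BoundedFormula.realize_all, BoundedFormula.realize_bdEqual, BoundedFormula.realize_iff,
    BoundedFormula.realize_rel₂, Term.realize_functions_apply₁]
  rfl

theorem realize_extensionAxiom (k : ℕ) (S : Finset (Fin k)) : V ⊨ extensionAxiom k S ↔
    ∀ x : Fin k → V, Function.Injective x → ∃ z, (∀ i, x i ≠ z) ∧ (∀ i ∈ S, RelMap adj ![x i, z]) ∧
      ∀ i ∉ S, ¬RelMap adj ![x i, z] := by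
  simp only [extensionAxiom, Sentence.Realize, BoundedFormula.realize_alls,
    BoundedFormula.realize_imp, BoundedFormula.realize_iInf, BoundedFormula.realize_not,
    BoundedFormula.realize_bdEqual, BoundedFormula.realize_ex, BoundedFormula.realize_inf,
    BoundedFormula.realize_rel₂, Function.comp_apply, Term.realize_var, Sum.elim_inr, Fin.snoc_castSucc, Fin.snoc_last,
    Subtype.forall]
  refine forall_congr' fun x => imp_congr ⟨fun h i j e => ?_, fun h q hq e => hq (h e)⟩ Iff.rfl
  by_contra hne
  exact h (i, j) hne e

theorem model_randomGraph_iff : V ⊨ randomGraph ↔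
    ∃ G : SimpleGraph V, (∀ x y, G.Adj x y ↔ RelMap adj ![x, y]) ∧ IsRandom G := by
  have h1 : V ⊨ randomGraph ↔ V ⊨ Theory.simpleGraph ∧
      ∀ (k : ℕ) (S : Finset (Fin k)), V ⊨ extensionAxiom k S := by
    unfold randomGraph
    rw [Theory.model_union_iff]
    refine and_congr_right fun _ => ?_
    rw [Theory.model_iff]
    exact ⟨fun h k S => h _ ⟨k, S, rfl⟩, fun h _ ⟨k, S, e⟩ => e ▸ h k S⟩
  rw [h1, Theory.simpleGraph_model_iff]
  simp only [realize_extensionAxiom]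
  constructor
  · rintro ⟨⟨h1, h2⟩, h3⟩
    refine ⟨⟨fun x y => RelMap adj ![x, y], h2, h1⟩, fun _ _ => Iff.rfl, fun S T hST => ?_⟩
    classical
    -- The axiom is used for the cardinality of `S ∪ T`, with the indices of `S` as the prescribed
    -- neighbours.
    let e := (S ∪ T).equivFin.symm
    have he : ∀ x (hx : x ∈ S ∪ T), (e (e.symm ⟨x, hx⟩) : V) = x := fun x hx => by simp
    obtain ⟨z, hz1, hz2, hz3⟩ := h3 (S ∪ T).card (Finset.univ.filter fun i => (e i : V) ∈ S)
      (fun i => e i) (fun i j h => e.injective (Subtype.ext h))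
    have hz1' : z ∉ S ∪ T := fun h => hz1 (e.symm ⟨z, h⟩) (he _ h)
    rw [Finset.mem_union, not_or] at hz1'
    refine ⟨z, hz1'.1, hz1'.2, fun x hx => ?_, fun x hx => ?_⟩
    · have hx' := Finset.mem_union_left T hx
      have := hz2 (e.symm ⟨x, hx'⟩) (by rw [Finset.mem_filter, he]; exact ⟨Finset.mem_univ _, hx⟩)
      rwa [he] at this
    · have hx' := Finset.mem_union_right S hx
      have := hz3 (e.symm ⟨x, hx'⟩) (by
        rw [Finset.mem_filter, he]
        exact fun h => Finset.disjoint_left.1 hST h.2 hx)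
      rwa [he] at this
  · rintro ⟨G, hG, hR⟩
    simp only [← hG]
    refine ⟨⟨G.loopless, G.symm⟩, fun k S x hx => ?_⟩
    classical
    obtain ⟨z, hz1, hz2, hz3, hz4⟩ := hR (S.image x) (Sᶜ.image x)
      ((Finset.disjoint_image hx).2 disjoint_compl_right)
    refine ⟨z, ?_, fun i hi => hz3 _ (Finset.mem_image_of_mem x hi), fun i hi => hz4 _
      (Finset.mem_image_of_mem x (Finset.mem_compl.2 hi))⟩
    rintro i rfl
    by_cases hi : i ∈ S
    · exact hz1 (Finset.mem_image_of_mem x hi)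
    · exact hz2 (Finset.mem_image_of_mem x (Finset.mem_compl.2 hi))

/-- The graph with an automorphism given by a model of `randomGraphAut`. -/
def Exp.toAutGraph (σ : Exp V randomGraphAut) : AutGraph V where
  Adj x y := RelMap adj ![x, y]
  symm := by
    obtain ⟨G, hG, _⟩ := model_randomGraph_iff.1 ((models_iff _).1 σ.models).1
    simp only [← hG]
    exact G.symm
  loopless := by
    obtain ⟨G, hG, _⟩ := model_randomGraph_iff.1 ((models_iff _).1 σ.models).1
    simp only [← hG]
    exact G.loopless
  aut :=
    { toFun := fwd σ.str
      invFun := bwd σ.str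
      left_inv := fun x => (((models_iff _).1 σ.models).2.1 x).2
      right_inv := fun x => (((models_iff _).1 σ.models).2.1 x).1 }
  adj_aut x y := (((models_iff _).1 σ.models).2.2 x y).symm

theorem Exp.isRandom (σ : Exp V randomGraphAut) : IsRandom σ.toAutGraph.toSimpleGraph := by
  obtain ⟨G, hG, h⟩ := model_randomGraph_iff.1 ((models_iff _).1 σ.models).1
  convert h
  ext x y
  exact (hG x y).symm

/-- The interpretation of `f` and `f⁻¹` by a permutation and its inverse. -/
@[reducible]
def permStr (f : Equiv.Perm V) : autLang.Structure V where
  funMap := fun {n} s => match n, s with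
    | _, AutFunctions.f => fun x => f (x 0)
    | _, AutFunctions.fInv => fun x => f.symm (x 0)
  RelMap := fun r => r.elim

/-- The model of `randomGraphAut` given by a graph with an automorphism. -/
def Exp.ofAutGraph (X : AutGraph V) (h : ∀ x y, X.Adj x y ↔ RelMap adj ![x, y])
    (hX : IsRandom X.toSimpleGraph) : Exp V randomGraphAut where
  str := permStr X.aut
  models := (models_iff _).2 ⟨model_randomGraph_iff.2 ⟨_, h, hX⟩,
    fun x => ⟨X.aut.apply_symm_apply x, X.aut.symm_apply_apply x⟩,
    fun x y => (h x y).symm.trans ((X.adj_aut x y).symm.trans (h _ _))⟩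

theorem Exp.toAutGraph_ofAutGraph (X : AutGraph V) (h : ∀ x y, X.Adj x y ↔ RelMap adj ![x, y])
    (hX : IsRandom X.toSimpleGraph) : (Exp.ofAutGraph X h hX).toAutGraph = X := by
  have h1 : (Exp.ofAutGraph X h hX).toAutGraph.toSimpleGraph = X.toSimpleGraph := by
    ext x y
    exact (h x y).symm
  have h2 : (Exp.ofAutGraph X h hX).toAutGraph.aut = X.aut := rfl
  generalize (Exp.ofAutGraph X h hX).toAutGraph = Y at h1 h2
  cases X; cases Y
  congr

theorem Exp.ext_aut {σ τ : Exp V randomGraphAut}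
    (h : ∀ x, σ.toAutGraph.aut x = τ.toAutGraph.aut x) : σ = τ := by
  have h' : σ.toAutGraph.aut = τ.toAutGraph.aut := Equiv.ext h
  exact Exp.ext (autLang_structure_ext h fun x => congrArg (fun e => e.symm x) h')

end

/-! ### Formulas and finite parts of a model. -/

section

variable {V : Type u} [Language.graph.Structure V]

/-- The value of a term in `(V, σ)`. -/
def termVal (σ : Exp V randomGraphAut) {β : Type v} (t : graphAut.Term β) (v : β → V) : V :=
  letI := expand (L := Language.graph) σ.str
  t.realize v

/-- Satisfaction of a bounded formula in `(V, σ)`. -/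
def BSat (σ : Exp V randomGraphAut) {α : Type v} {n : ℕ} (φ : graphAut.BoundedFormula α n)
    (v : α → V) (xs : Fin n → V) : Prop :=
  letI := expand (L := Language.graph) σ.str
  φ.Realize v xs

theorem termVal_f (σ : Exp V randomGraphAut) {β : Type v} (ts : Fin 1 → graphAut.Term β)
    (v : β → V) : termVal σ (Term.func (Sum.inr AutFunctions.f : graphAut.Functions 1) ts) v =
      σ.toAutGraph.aut (termVal σ (ts 0) v) :=
  congrArg (σ.str.funMap AutFunctions.f) (List.ofFn_inj.1 rfl)

theorem termVal_fInv (σ : Exp V randomGraphAut) {β : Type v} (ts : Fin 1 → graphAut.Term β)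
    (v : β → V) : termVal σ (Term.func (Sum.inr AutFunctions.fInv : graphAut.Functions 1) ts) v =
      σ.toAutGraph.aut.symm (termVal σ (ts 0) v) :=
  congrArg (σ.str.funMap AutFunctions.fInv) (List.ofFn_inj.1 rfl)

section

variable {α : Type v} {n : ℕ} (σ : Exp V randomGraphAut) (v : α → V) (xs : Fin n → V)

theorem bSat_equal (t₁ t₂ : graphAut.Term (α ⊕ Fin n)) : BSat σ (t₁.bdEqual t₂) v xs ↔
    termVal σ t₁ (Sum.elim v xs) = termVal σ t₂ (Sum.elim v xs) :=
  Iff.rfl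

theorem bSat_adj (ts : Fin 2 → graphAut.Term (α ⊕ Fin n)) :
    BSat σ (Relations.boundedFormula (L := graphAut) (Sum.inl graphRel.adj) ts) v xs ↔
      σ.toAutGraph.Adj (termVal σ (ts 0) (Sum.elim v xs)) (termVal σ (ts 1) (Sum.elim v xs)) :=
  iff_of_eq (congrArg (RelMap adj) (List.ofFn_inj.1 rfl))

theorem bSat_inf (φ ψ : graphAut.BoundedFormula α n) :
    BSat σ (φ ⊓ ψ) v xs ↔ BSat σ φ v xs ∧ BSat σ ψ v xs :=
  letI := expand (L := Language.graph) σ.str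
  BoundedFormula.realize_inf

theorem bSat_top : BSat σ (⊤ : graphAut.BoundedFormula α n) v xs :=
  letI := expand (L := Language.graph) σ.str
  BoundedFormula.realize_top.2 trivial

theorem bSat_iInf {β : Type w} [Finite β] (φ : β → graphAut.BoundedFormula α n) :
    BSat σ (BoundedFormula.iInf φ) v xs ↔ ∀ b, BSat σ (φ b) v xs :=
  letI := expand (L := Language.graph) σ.str
  BoundedFormula.realize_iInf

theorem bSat_all (φ : graphAut.BoundedFormula α (n + 1)) :
    BSat σ φ.all v xs ↔ ∀ a, BSat σ φ v (Fin.snoc xs a) :=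
  Iff.rfl

theorem bSat_ex (φ : graphAut.BoundedFormula α (n + 1)) :
    BSat σ φ.ex v xs ↔ ∃ a, BSat σ φ v (Fin.snoc xs a) :=
  letI := expand (L := Language.graph) σ.str
  BoundedFormula.realize_ex

end

/-- The value of a term depends on a finite part of the structure only. -/
theorem exists_finite_termVal (σ : Exp V randomGraphAut) {β : Type v} (t : graphAut.Term β)
    (v : β → V) : ∃ W : Set V, W.Finite ∧ termVal σ t v ∈ W ∧
      ∀ (V' : Type w) [Language.graph.Structure V'] (σ' : Exp V' randomGraphAut) (h : V → V')
        (v' : β → V'), PreservesOn σ.toAutGraph σ'.toAutGraph h W →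
          (∀ i, v i ∈ W → v' i = h (v i)) → termVal σ' t v' = h (termVal σ t v) := by
  induction t with
  | var i => exact ⟨{v i}, Set.finite_singleton _, rfl, fun _ _ _ _ _ _ hv => hv i rfl⟩
  | @func l s ts ih =>
    rcases s with s | s
    · exact s.elim
    cases s with
    | f =>
      obtain ⟨W, hW, hmem, H⟩ := ih 0
      refine ⟨insert (termVal σ (Term.func (Sum.inr AutFunctions.f : graphAut.Functions 1) ts) v) W,
        hW.insert _, Set.mem_insert _ _, fun V' _ σ' h v' hh hv => ?_⟩
      refine (termVal_f σ' ts _).trans (Eq.trans ?_ (congrArg h (termVal_f σ ts v)).symm)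
      rw [H V' σ' h v' (hh.mono (Set.subset_insert _ _))
        fun i hi => hv i (Set.mem_insert_of_mem _ hi)]
      refine (hh.aut _ (Set.mem_insert_of_mem _ hmem) ?_).symm
      rw [← termVal_f]
      exact Set.mem_insert _ _
    | fInv =>
      obtain ⟨W, hW, hmem, H⟩ := ih 0
      refine ⟨insert (termVal σ (Term.func (Sum.inr AutFunctions.fInv : graphAut.Functions 1) ts) v)
        W, hW.insert _, Set.mem_insert _ _, fun V' _ σ' h v' hh hv => ?_⟩
      -- `PreservesOn` concerns the forward automorphism only, so it is applied at the value of the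
      -- inverse term, which was put into `W` for this purpose.
      have h1 := hh.aut _ (Set.mem_insert _ _)
        (by rw [termVal_fInv, Equiv.apply_symm_apply]; exact Set.mem_insert_of_mem _ hmem)
      refine (termVal_fInv σ' ts _).trans ?_
      rw [H V' σ' h v' (hh.mono (Set.subset_insert _ _))
        fun i hi => hv i (Set.mem_insert_of_mem _ hi), Equiv.symm_apply_eq]
      refine Eq.trans ?_ h1
      rw [termVal_fInv, Equiv.apply_symm_apply]

/-- Truth of a quantifier-free formula depends on a finite part of the structure only. -/
theorem exists_finite_of_isQF (σ : Exp V randomGraphAut) {α : Type v} {n : ℕ}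
    {φ : graphAut.BoundedFormula α n} (hφ : φ.IsQF) (v : α → V) (xs : Fin n → V) :
    ∃ W : Set V, W.Finite ∧
      ∀ (V' : Type w) [Language.graph.Structure V'] (σ' : Exp V' randomGraphAut) (h : V → V')
        (v' : α → V'), PreservesOn σ.toAutGraph σ'.toAutGraph h W →
          (∀ i, v i ∈ W → v' i = h (v i)) → (BSat σ' φ v' (h ∘ xs) ↔ BSat σ φ v xs) := by
  have hsum : ∀ {V' : Type w} {W W' : Set V} {h : V → V'} {v' : α → V'}, W' ⊆ W →
      (∀ i, v i ∈ W → v' i = h (v i)) →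
      ∀ i, Sum.elim v xs i ∈ W' → Sum.elim v' (h ∘ xs) i = h (Sum.elim v xs i) := by
    rintro V' W W' h v' hW hv (i | i) hi
    · exact hv i (hW hi)
    · rfl
  induction hφ with
  | falsum => exact ⟨∅, Set.finite_empty, fun _ _ _ _ _ _ _ => Iff.rfl⟩
  | of_isAtomic hφ =>
    cases hφ with
    | equal t₁ t₂ =>
      obtain ⟨W₁, hW₁, m₁, H₁⟩ := exists_finite_termVal.{u, v, w} σ t₁ (Sum.elim v xs)
      obtain ⟨W₂, hW₂, m₂, H₂⟩ := exists_finite_termVal.{u, v, w} σ t₂ (Sum.elim v xs)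
      refine ⟨W₁ ∪ W₂, hW₁.union hW₂, fun V' _ σ' h v' hh hv => ?_⟩
      rw [bSat_equal, bSat_equal,
        H₁ V' σ' h _ (hh.mono Set.subset_union_left) (hsum Set.subset_union_left hv),
        H₂ V' σ' h _ (hh.mono Set.subset_union_right) (hsum Set.subset_union_right hv)]
      exact ⟨fun e => hh.inj _ (.inl m₁) _ (.inr m₂) e, fun e => congrArg h e⟩
    | @rel l R ts =>
      rcases R with R | R
      · cases R
        obtain ⟨W₁, hW₁, m₁, H₁⟩ := exists_finite_termVal.{u, v, w} σ (ts 0) (Sum.elim v xs)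
        obtain ⟨W₂, hW₂, m₂, H₂⟩ := exists_finite_termVal.{u, v, w} σ (ts 1) (Sum.elim v xs)
        refine ⟨W₁ ∪ W₂, hW₁.union hW₂, fun V' _ σ' h v' hh hv => ?_⟩
        refine (bSat_adj σ' _ _ ts).trans (Iff.trans ?_ (bSat_adj σ _ _ ts).symm)
        rw [H₁ V' σ' h _ (hh.mono Set.subset_union_left) (hsum Set.subset_union_left hv),
          H₂ V' σ' h _ (hh.mono Set.subset_union_right) (hsum Set.subset_union_right hv)]
        exact hh.adj _ (.inl m₁) _ (.inr m₂)
      · exact R.elim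
  | imp _ _ ih₁ ih₂ =>
    obtain ⟨W₁, hW₁, H₁⟩ := ih₁
    obtain ⟨W₂, hW₂, H₂⟩ := ih₂
    exact ⟨W₁ ∪ W₂, hW₁.union hW₂, fun V' _ σ' h v' hh hv =>
      imp_congr (H₁ V' σ' h v' (hh.mono Set.subset_union_left) fun i hi => hv i (.inl hi))
        (H₂ V' σ' h v' (hh.mono Set.subset_union_right) fun i hi => hv i (.inr hi))⟩

/-- A true existential formula has a finite witness. -/
theorem exists_finite_of_isExistential (σ : Exp V randomGraphAut) {α : Type v} {n : ℕ}
    {φ : graphAut.BoundedFormula α n} (hφ : φ.IsExistential) (v : α → V) (xs : Fin n → V)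
    (hs : BSat σ φ v xs) : ∃ W : Set V, W.Finite ∧
      ∀ (V' : Type w) [Language.graph.Structure V'] (σ' : Exp V' randomGraphAut) (h : V → V'),
        PreservesOn σ.toAutGraph σ'.toAutGraph h W → BSat σ' φ (h ∘ v) (h ∘ xs) := by
  induction hφ with
  | of_isQF hφ =>
    obtain ⟨W, hW, H⟩ := exists_finite_of_isQF.{u, v, w} σ hφ v xs
    exact ⟨W, hW, fun V' _ σ' h hh => (H V' σ' h _ hh fun _ _ => rfl).2 hs⟩
  | ex _ ih =>
    obtain ⟨a, ha⟩ := (bSat_ex _ _ _ _).1 hs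
    obtain ⟨W, hW, H⟩ := ih _ ha
    refine ⟨W, hW, fun V' _ σ' h hh => (bSat_ex _ _ _ _).2 ⟨h a, ?_⟩⟩
    have := H V' σ' h hh
    rwa [Fin.comp_snoc] at this

/-- A false universal formula has a finite witness. -/
theorem exists_finite_of_isUniversal (σ : Exp V randomGraphAut) {α : Type v} {n : ℕ}
    {φ : graphAut.BoundedFormula α n} (hφ : φ.IsUniversal) (v : α → V) (xs : Fin n → V)
    (hs : ¬BSat σ φ v xs) : ∃ W : Set V, W.Finite ∧
      ∀ (V' : Type w) [Language.graph.Structure V'] (σ' : Exp V' randomGraphAut) (h : V → V'),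
        PreservesOn σ.toAutGraph σ'.toAutGraph h W → ¬BSat σ' φ (h ∘ v) (h ∘ xs) := by
  induction hφ with
  | of_isQF hφ =>
    obtain ⟨W, hW, H⟩ := exists_finite_of_isQF.{u, v, w} σ hφ v xs
    exact ⟨W, hW, fun V' _ σ' h hh => (H V' σ' h _ hh fun _ _ => rfl).not.2 hs⟩
  | all _ ih =>
    obtain ⟨a, ha⟩ := not_forall.1 fun hall => hs ((bSat_all _ _ _ _).2 hall)
    obtain ⟨W, hW, H⟩ := ih _ ha
    refine ⟨W, hW, fun V' _ σ' h hh hs' => ?_⟩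
    have := H V' σ' h hh
    rw [Fin.comp_snoc] at this
    exact this ((bSat_all _ _ _ _).1 hs' (h a))

theorem isQF_iInf {L : FirstOrder.Language.{0, 0}} {α : Type v} {β : Type w} [Finite β] {n : ℕ}
    {φ : β → L.BoundedFormula α n} (h : ∀ b, (φ b).IsQF) : (BoundedFormula.iInf φ).IsQF := by
  unfold BoundedFormula.iInf
  dsimp only
  generalize Finset.toList _ = l
  induction l with
  | nil => exact BoundedFormula.IsQF.top
  | cons b l ih => exact (h b).inf ih

theorem isExistential_exs {L : FirstOrder.Language.{0, 0}} {α : Type v} {n : ℕ}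
    {φ : L.BoundedFormula α n} (h : φ.IsExistential) :
    (φ.exs : L.BoundedFormula α 0).IsExistential := by
  induction n with
  | zero => exact h
  | succ n ih => exact ih h.ex

theorem isExistential_iExs {L : FirstOrder.Language.{0, 0}} {α : Type v} {β : Type w} [Finite β]
    {φ : L.Formula (α ⊕ β)} (h : φ.IsQF) : (φ.iExs β).IsExistential :=
  isExistential_exs (h.relabel _).isExistential

open Classical in
/-- The quantifier-free formula that describes equality, adjacency and the automorphism on the
tuple `y`. -/
noncomputable def diagFormula {V : Type u} {ι : Type v} [Finite ι] (X : AutGraph V) (y : ι → V) :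
    graphAut.Formula ι :=
  BoundedFormula.iInf fun p : ι × ι =>
    (if y p.1 = y p.2 then (Term.var (.inl p.1)).bdEqual (Term.var (.inl p.2))
      else ∼((Term.var (.inl p.1)).bdEqual (Term.var (.inl p.2)))) ⊓
    ((if X.Adj (y p.1) (y p.2) then adjSym.boundedFormula ![Term.var (.inl p.1), Term.var (.inl p.2)]
      else ∼(adjSym.boundedFormula ![Term.var (.inl p.1), Term.var (.inl p.2)])) ⊓
    (if X.aut (y p.1) = y p.2 then
        (Term.func fSym ![Term.var (.inl p.1)]).bdEqual (Term.var (.inl p.2))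
      else ⊤))

theorem isQF_diagFormula {V : Type u} {ι : Type v} [Finite ι] (X : AutGraph V) (y : ι → V) :
    (diagFormula X y).IsQF := by
  have he : ∀ s t : graphAut.Term (ι ⊕ Fin 0), (s.bdEqual t).IsQF := fun s t =>
    (BoundedFormula.IsAtomic.equal s t).isQF
  have hr : ∀ ts : Fin 2 → graphAut.Term (ι ⊕ Fin 0), (adjSym.boundedFormula ts).IsQF := fun ts =>
    (BoundedFormula.IsAtomic.rel _ ts).isQF
  refine isQF_iInf fun p => .inf ?_ (.inf ?_ ?_) <;> split_ifs
  exacts [he _ _, (he _ _).not, hr _, (hr _).not, he _ _, .top]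

/-- The automorphism enters only through the true equations within the tuple, which is all that
`PreservesOn` asks on the range of `y`. -/
theorem sat_diagFormula {V : Type u} {V' : Type w} [Language.graph.Structure V'] {ι : Type v}
    [Finite ι] (X : AutGraph V) (y : ι → V) (σ : Exp V' randomGraphAut) (z : ι → V') :
    Sat σ.str (diagFormula X y) z ↔ ∀ i j, (z i = z j ↔ y i = y j) ∧
      (σ.toAutGraph.Adj (z i) (z j) ↔ X.Adj (y i) (y j)) ∧
      (X.aut (y i) = y j → σ.toAutGraph.aut (z i) = z j) := by
  refine (bSat_iInf σ z default _).trans (Prod.forall.trans ?_)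
  refine forall₂_congr fun i j => (bSat_inf _ _ _ _ _).trans (and_congr ?_
    ((bSat_inf _ _ _ _ _).trans (and_congr ?_ ?_)))
  · have h1 := bSat_equal (n := 0) σ z default (Term.var (.inl i)) (Term.var (.inl j))
    split_ifs with h
    · exact h1.trans ⟨fun e => iff_of_true e h, fun e => e.2 h⟩
    · exact h1.not.trans ⟨fun e => iff_of_false e h, fun e e' => h (e.1 e')⟩
  · have h1 := bSat_adj (n := 0) σ z default ![Term.var (.inl i), Term.var (.inl j)]
    split_ifs with h
    · exact h1.trans ⟨fun e => iff_of_true e h, fun e => e.2 h⟩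
    · exact h1.not.trans ⟨fun e => iff_of_false e h, fun e e' => h (e.1 e')⟩
  · split_ifs with h
    · have h1 := termVal_f σ ![Term.var (.inl i)] (Sum.elim z (default : Fin 0 → V'))
      exact (bSat_equal _ _ _ _ _).trans ⟨fun e _ => h1.symm.trans e, fun e => h1.trans (e h)⟩
    · exact iff_of_true (bSat_top _ _ _) fun h' => absurd h' h

/-- This turns solutions of a formula back into partial embeddings; the values of `k` off the range
of `y` are arbitrary. -/
theorem exists_preservesOn_of_sat {V : Type u} {V' : Type w} [Nonempty V']
    [Language.graph.Structure V'] {ι : Type v} [Finite ι] {X : AutGraph V} {y : ι → V}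
    {σ : Exp V' randomGraphAut} {z : ι → V'} (h : Sat σ.str (diagFormula X y) z) :
    ∃ k : V → V', PreservesOn X σ.toAutGraph k (Set.range y) ∧ ∀ i, k (y i) = z i := by
  rw [sat_diagFormula] at h
  have hk : ∀ x : V, ∃ x' : V', ∀ i, y i = x → x' = z i := by
    intro x
    by_cases hx : ∃ i, y i = x
    · obtain ⟨i, rfl⟩ := hx
      exact ⟨z i, fun j hj => (h i j).1.2 hj.symm⟩
    · exact ⟨Classical.arbitrary V', fun i hi => absurd ⟨i, hi⟩ hx⟩
  choose k hk using hk
  have hk' : ∀ i, k (y i) = z i := fun i => hk _ i rfl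
  refine ⟨k, ⟨?_, ?_, ?_⟩, hk'⟩
  · rintro _ ⟨i, rfl⟩ _ ⟨j, rfl⟩ e
    rw [hk', hk'] at e
    exact (h i j).1.1 e
  · rintro _ ⟨i, rfl⟩ _ ⟨j, rfl⟩
    rw [hk', hk']
    exact (h i j).2.1
  · rintro _ ⟨i, rfl⟩ ⟨j, hj⟩
    rw [← hj, hk', hk']
    exact ((h i j).2.2 hj.symm).symm

theorem sat_diagFormula_self (σ : Exp V randomGraphAut) {ι : Type v} [Finite ι] (y : ι → V) :
    Sat σ.str (diagFormula σ.toAutGraph y) y :=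
  (sat_diagFormula _ _ _ _).2 fun _ _ => ⟨Iff.rfl, Iff.rfl, id⟩

end

/-! ### Existential closedness and smoothness. -/

section

variable {N : Type u} [Language.graph.Structure N]

/-- Maps that preserve everything are embeddings of structures. -/
theorem PreservesOn.exists_embedding {U : Type v} [Language.graph.Structure U]
    {σ : Exp N randomGraphAut} {υ : Exp U randomGraphAut} {j : N → U}
    (hj : PreservesOn σ.toAutGraph υ.toAutGraph j Set.univ) :
    letI := expand (L := Language.graph) σ.str
    letI := expand (L := Language.graph) υ.str
    ∃ e : N ↪[graphAut] U, ∀ x, e x = j x := by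
  let _ := expand (L := Language.graph) σ.str
  let _ := expand (L := Language.graph) υ.str
  have h1 : ∀ x, j (σ.toAutGraph.aut x) = υ.toAutGraph.aut (j x) := fun x => hj.aut x trivial trivial
  have h2 : ∀ x, j (σ.toAutGraph.aut.symm x) = υ.toAutGraph.aut.symm (j x) := fun x => by
    rw [Equiv.eq_symm_apply, ← h1, Equiv.apply_symm_apply]
  refine ⟨⟨⟨j, fun x y e => hj.inj x trivial y trivial e⟩, ?_, ?_⟩, fun _ => rfl⟩
  · rintro n (s | s) x
    · exact s.elim
    · cases s
      · have hx : x = ![x 0] := List.ofFn_inj.1 rfl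
        have hx' : j ∘ x = ![j (x 0)] := List.ofFn_inj.1 rfl
        refine (congrArg (fun y => j (σ.str.funMap AutFunctions.f y)) hx).trans ((h1 (x 0)).trans ?_)
        exact congrArg (υ.str.funMap AutFunctions.f) hx'.symm
      · have hx : x = ![x 0] := List.ofFn_inj.1 rfl
        have hx' : j ∘ x = ![j (x 0)] := List.ofFn_inj.1 rfl
        refine (congrArg (fun y => j (σ.str.funMap AutFunctions.fInv y)) hx).trans
          ((h2 (x 0)).trans ?_)
        exact congrArg (υ.str.funMap AutFunctions.fInv) hx'.symm
  · rintro n (s | s) x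
    · cases s
      have hx : x = ![x 0, x 1] := List.ofFn_inj.1 rfl
      have hx' : j ∘ x = ![j (x 0), j (x 1)] := List.ofFn_inj.1 rfl
      have h := hj.adj (x 0) trivial (x 1) trivial
      change RelMap Language.adj ![j (x 0), j (x 1)] ↔ RelMap Language.adj ![x 0, x 1] at h
      rw [← hx', ← hx] at h
      exact h
    · exact s.elim

/-- Embeddings of structures preserve everything. -/
theorem preservesOn_embedding {U : Type v} [Language.graph.Structure U]
    {σ : Exp N randomGraphAut} {υ : Exp U randomGraphAut}
    (e : letI := expand (L := Language.graph) σ.str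
         letI := expand (L := Language.graph) υ.str
         N ↪[graphAut] U) :
    PreservesOn σ.toAutGraph υ.toAutGraph
      (letI := expand (L := Language.graph) σ.str
       letI := expand (L := Language.graph) υ.str
       (e : N → U)) Set.univ := by
  let _ := expand (L := Language.graph) σ.str
  let _ := expand (L := Language.graph) υ.str
  refine ⟨fun x _ y _ h => e.injective h, fun x _ y _ => ?_, fun x _ _ => ?_⟩
  · have h1 := e.map_rel (Sum.inl graphRel.adj : graphAut.Relations 2) ![x, y]
    have h2 : e ∘ ![x, y] = ![e x, e y] := List.ofFn_inj.1 rfl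
    rw [h2] at h1
    exact h1
  · have h1 := e.map_fun (Sum.inr AutFunctions.f : graphAut.Functions 1) ![x]
    have h2 : e ∘ ![x] = ![e x] := List.ofFn_inj.1 rfl
    rw [h2] at h1
    exact h1

theorem Exp.nonempty (σ : Exp N randomGraphAut) : Nonempty N :=
  σ.isRandom.nonempty

/-- An existentially closed model realizes over finite sets the finite parts of every extension. -/
theorem IsEC.absorbs {σ : Exp N randomGraphAut} (hσ : IsEC σ) {U : Type u} {Z : AutGraph U}
    {i : N → U} (hi : PreservesOn σ.toAutGraph Z i Set.univ) {W : Set U} (hW : W.Finite)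
    {A : Set N} (hA : A.Finite) :
    ∃ h : U → N, PreservesOn Z σ.toAutGraph h W ∧ ∀ a ∈ A, h (i a) = a := by
  have := σ.nonempty
  have : Finite W := hW
  have : Finite A := hA
  -- Existential closedness only looks at models of the theory, and `Z` need not be random; its hull
  -- is.
  let _ : Language.graph.Structure (Hull U) := (Hull.autGraph Z).toSimpleGraph.structure
  let υ : Exp (Hull U) randomGraphAut :=
    Exp.ofAutGraph (Hull.autGraph Z) (fun _ _ => Iff.rfl) (Hull.isRandom_autGraph Z)
  have hυ : υ.toAutGraph = Hull.autGraph Z := Exp.toAutGraph_ofAutGraph _ _ _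
  have hj : PreservesOn σ.toAutGraph υ.toAutGraph (Hull.base ∘ i) Set.univ := by
    rw [hυ]
    exact (Hull.preservesOn_base Z).comp hi (Set.mapsTo_univ _ _)
  obtain ⟨e, he⟩ := hj.exists_embedding
  obtain ⟨n, ⟨ε⟩⟩ := Finite.exists_equiv_fin W
  -- In the formula to be solved, the points of `A` become parameters and those of `W` unknowns.
  let y : A ⊕ W → Hull U := Sum.elim (fun a => e a) (fun x => Hull.base x)
  obtain ⟨x, hx⟩ := hσ n ((diagFormula υ.toAutGraph y).relabel (Sum.map Subtype.val ε))
    ((isQF_diagFormula _ _).relabel _)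
    ⟨Hull U, _, υ, e, fun t => Hull.base (ε.symm t), by
      let _ := expand (L := Language.graph) υ.str
      refine Formula.realize_relabel.2 ?_
      refine Eq.mp (congrArg (Sat υ.str (diagFormula υ.toAutGraph y)) ?_)
        (sat_diagFormula_self υ y)
      funext t
      rcases t with t | t <;> simp [y]⟩
  have hx' : Sat σ.str (diagFormula υ.toAutGraph y)
      (Sum.elim id x ∘ Sum.map Subtype.val ε) := by
    let _ := expand (L := Language.graph) σ.str
    exact Formula.realize_relabel.1 hx
  obtain ⟨k, hk, hk'⟩ := exists_preservesOn_of_sat hx'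
  rw [hυ] at hk
  refine ⟨k ∘ Hull.base, hk.comp ((Hull.preservesOn_base Z).mono (Set.subset_univ _))
    fun w hw => ⟨.inr ⟨w, hw⟩, rfl⟩, fun a ha => ?_⟩
  have := hk' (.inl ⟨a, ha⟩)
  simpa [y, he] using this

theorem IsGenericAut.isEC {σ : Exp N randomGraphAut} (hσ : IsGenericAut σ.toAutGraph) :
    IsEC σ := by
  rintro n φ hφ ⟨U, _, υ, j, x, hx⟩
  have := σ.nonempty
  have hj := preservesOn_embedding j
  obtain ⟨W, hW, H⟩ := exists_finite_of_isQF.{u, u, u} υ hφ (Sum.elim j x) default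
  -- Of the parameters only those whose image lies in the finite witness `W` matter, so it is enough
  -- that `h` sends these back to themselves.
  have hjW : (j ⁻¹' W).Finite := hW.preimage fun a _ b _ e => hj.inj a trivial b trivial e
  obtain ⟨A, hA, hA1, hA2⟩ := hσ.exists_finite_invariant hjW
  obtain ⟨h, hh, hh'⟩ := hσ.absorbs hA1 hA2 (hj.mono (Set.subset_univ _)) hW
  refine ⟨h ∘ x, ?_⟩
  have h1 := (H N σ h (Sum.elim id (h ∘ x)) hh ?_).2 hx
  · rwa [Subsingleton.elim (h ∘ default) default] at h1
  · rintro (a | t) ha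
    · exact (hh' a (hA ha)).symm
    · rfl

/-- Tuples in the countable random graph with the same equalities and adjacencies are conjugate. -/
theorem exists_graph_equiv [Countable N] (σ : Exp N randomGraphAut) {ι : Type v} [Finite ι]
    {u u' : ι → N} (h : ∀ i j, (u i = u j ↔ u' i = u' j) ∧
      (σ.toAutGraph.Adj (u i) (u j) ↔ σ.toAutGraph.Adj (u' i) (u' j))) :
    ∃ g : N ≃[Language.graph] N, ∀ i, g (u i) = u' i := by
  have h1 : IsPartialIso σ.toAutGraph.toSimpleGraph σ.toAutGraph.toSimpleGraph
      (Set.range fun i => (u i, u' i)) := by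
    rintro _ ⟨i, rfl⟩ _ ⟨j, rfl⟩
    exact h i j
  obtain ⟨e, he, he'⟩ := h1.exists_equiv σ.isRandom σ.isRandom (Set.finite_range _)
  refine ⟨⟨e, fun s => s.elim, ?_⟩, fun i => he _ ⟨i, rfl⟩⟩
  rintro n s x
  cases s
  have hx : x = ![x 0, x 1] := List.ofFn_inj.1 rfl
  have hx' : e ∘ x = ![e (x 0), e (x 1)] := List.ofFn_inj.1 rfl
  refine (iff_of_eq (congrArg (RelMap adj) hx')).trans ((he' _ _).trans ?_)
  exact iff_of_eq (congrArg (RelMap adj) hx.symm)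

/-- Such tuples satisfy the same formulas. -/
theorem realize_iff_of_same_diagram [Countable N] (σ : Exp N randomGraphAut) {ι : Type v} [Finite ι]
    {u u' : ι → N} (h : ∀ i j, (u i = u j ↔ u' i = u' j) ∧
      (σ.toAutGraph.Adj (u i) (u j) ↔ σ.toAutGraph.Adj (u' i) (u' j)))
    (ξ : Language.graph.Formula ι) : ξ.Realize u ↔ ξ.Realize u' := by
  obtain ⟨g, hg⟩ := exists_graph_equiv σ h
  rw [← StrongHomClass.realize_formula g ξ, show g ∘ u = u' from funext hg]

/-- A tuple has finitely many patterns of equality and adjacency over the parameters, and by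
homogeneity the pattern decides every formula of the base language. If the type were omitted, a
single formula of `p` would exclude each pattern of a solution of `ψ`, and finitely many formulas
would exclude them all. -/
theorem isSmooth [Countable N] (σ : Exp N randomGraphAut) : IsSmooth σ := by
  classical
  intro n A p ψ _ hfin
  by_contra! hcon
  let t : (Fin n → N) → A ⊕ Fin n → N := fun x => Sum.elim (fun a : A => (a : N)) x
  let c : (Fin n → N) → (A ⊕ Fin n → A ⊕ Fin n → Prop × Prop) := fun x i j =>
    (t x i = t x j, σ.toAutGraph.Adj (t x i) (t x j))
  have hc : ∀ x x', c x = c x' → ∀ ξ : Language.graph.Formula (A ⊕ Fin n),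
      ξ.Realize (t x) ↔ ξ.Realize (t x') := by
    intro x x' e
    refine realize_iff_of_same_diagram σ fun i j => ?_
    have := congrFun (congrFun e i) j
    rw [Prod.mk.injEq] at this
    exact ⟨iff_of_eq this.1, iff_of_eq this.2⟩
  have hq : ∀ k, ∃ q : Finset (Language.graph.Formula (A ⊕ Fin n)),
      (q : Set (Language.graph.Formula (A ⊕ Fin n))) ⊆ p ∧
        ∀ x, c x = k → Sat σ.str ψ (t x) → ∃ ξ ∈ q, ¬ξ.Realize (t x) := by
    intro k
    by_cases hk : ∃ x, c x = k ∧ ∃ ξ ∈ p, ¬ξ.Realize (t x)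
    · obtain ⟨x, hx, ξ, hξ, hξ'⟩ := hk
      refine ⟨{ξ}, by simpa using hξ, fun x' hx' _ => ⟨ξ, Finset.mem_singleton_self _, ?_⟩⟩
      rwa [hc x' x (hx'.trans hx.symm)]
    · push Not at hk
      exact ⟨∅, by simp, fun x hx hψ => absurd hψ (hcon x (hk x hx))⟩
  choose q hqp hq using hq
  have := Fintype.ofFinite (A ⊕ Fin n → A ⊕ Fin n → Prop × Prop)
  obtain ⟨x, hx, hx'⟩ := hfin (Finset.univ.biUnion q) (by
    intro ξ hξ
    obtain ⟨k, -, hk⟩ := Finset.mem_biUnion.1 (Finset.mem_coe.1 hξ)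
    exact hqp k hk)
  obtain ⟨ξ, hξ, hξ'⟩ := hq (c x) x rfl hx'
  exact hξ' (hx ξ (Finset.mem_biUnion.2 ⟨_, Finset.mem_univ _, hξ⟩))

end

/-! ### The topology of `Exp` and comeagreness of genericity. -/

section

variable {N : Type u} [Language.graph.Structure N]

theorem preservesOn_id {σ σ' : Exp N randomGraphAut} {W : Set N}
    (h : ∀ x ∈ W, σ'.toAutGraph.aut x = σ.toAutGraph.aut x) :
    PreservesOn σ.toAutGraph σ'.toAutGraph id W :=
  ⟨fun _ _ _ _ e => e, fun _ _ _ _ => Iff.rfl, fun x hx _ => (h x hx).symm⟩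

theorem isOpen_aut_eq (x y : N) :
    IsOpen {σ : Exp N randomGraphAut | σ.toAutGraph.aut x = y} := by
  refine TopologicalSpace.isOpen_generateFrom_of_mem
    ⟨(Term.func fSym ![Term.var (.inl x)]).bdEqual (Term.var (.inl y)),
      (BoundedFormula.IsAtomic.equal _ _).isQF, ?_⟩
  ext σ
  have h1 := termVal_f σ ![Term.var (.inl x)] (Sum.elim id (default : Fin 0 → N))
  have h2 := bSat_equal (n := 0) σ id default (Term.func fSym ![Term.var (.inl x)])
    (Term.var (.inl y))
  exact ⟨fun h => h2.2 (h1.trans h), fun h => h1.symm.trans (h2.1 h)⟩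

/-- A quantifier-free sentence sees only a finite part of the structure, and an equation for the
inverse is one for the automorphism. The topology is thus that of pointwise convergence of the
automorphism alone. -/
theorem isOpen_exp_iff {S : Set (Exp N randomGraphAut)} : IsOpen S ↔
    ∀ σ ∈ S, ∃ F : Finset N, ∀ σ' : Exp N randomGraphAut,
      (∀ x ∈ F, σ'.toAutGraph.aut x = σ.toAutGraph.aut x) → σ' ∈ S := by
  classical
  constructor
  · intro hS
    induction hS with
    | basic S hS =>
      obtain ⟨φ, hφ, rfl⟩ := hS
      intro σ hσ
      obtain ⟨W, hW, H⟩ := exists_finite_of_isQF.{u, u, u} σ hφ id default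
      refine ⟨hW.toFinset, fun σ' h => ?_⟩
      have h1 := (H N σ' id id (preservesOn_id fun x hx => h x (hW.mem_toFinset.2 hx))
        fun _ _ => rfl).2 hσ
      exact h1
    | univ => exact fun σ _ => ⟨∅, fun _ _ => trivial⟩
    | inter S T _ _ ihS ihT =>
      intro σ hσ
      obtain ⟨F, hF⟩ := ihS σ hσ.1
      obtain ⟨G, hG⟩ := ihT σ hσ.2
      exact ⟨F ∪ G, fun σ' h => ⟨hF σ' fun x hx => h x (Finset.mem_union_left _ hx),
        hG σ' fun x hx => h x (Finset.mem_union_right _ hx)⟩⟩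
    | sUnion 𝒮 _ ih =>
      rintro σ ⟨S, hS, hσ⟩
      obtain ⟨F, hF⟩ := ih S hS σ hσ
      exact ⟨F, fun σ' h => ⟨S, hS, hF σ' h⟩⟩
  · intro h
    rw [isOpen_iff_mem_nhds]
    intro σ hσ
    obtain ⟨F, hF⟩ := h σ hσ
    have h1 : (⋂ x ∈ F, {σ' : Exp N randomGraphAut | σ'.toAutGraph.aut x = σ.toAutGraph.aut x}) ∈
        𝓝 σ :=
      (Filter.biInter_finset_mem F).2 fun x _ => (isOpen_aut_eq x _).mem_nhds rfl
    exact Filter.mem_of_superset h1 fun σ' hσ' => hF σ' (by simpa using hσ')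

theorem dense_exp {S : Set (Exp N randomGraphAut)}
    (h : ∀ (σ : Exp N randomGraphAut) (F : Finset N), ∃ σ' ∈ S,
      ∀ x ∈ F, σ'.toAutGraph.aut x = σ.toAutGraph.aut x) : Dense S := by
  rw [dense_iff_inter_open]
  rintro U hU ⟨σ, hσ⟩
  obtain ⟨F, hF⟩ := isOpen_exp_iff.1 hU σ hσ
  obtain ⟨σ', h1, h2⟩ := h σ F
  exact ⟨σ', hF σ' h2, h1⟩

/-- The space of automorphisms of the countable random graph is a Baire space. -/
theorem baireSpace_exp [Countable N] (σ₀ : Exp N randomGraphAut) :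
    BaireSpace (Exp N randomGraphAut) := by
  let _ : TopologicalSpace N := ⊥
  have : DiscreteTopology N := ⟨rfl⟩
  -- The inverse is recorded as well, because being a permutation is not a closed condition on a
  -- map, whereas being mutually inverse is one on a pair.
  let Φ : Exp N randomGraphAut → (N → N) × (N → N) := fun σ =>
    (σ.toAutGraph.aut, σ.toAutGraph.aut.symm)
  have hcont : Continuous Φ := by
    refine Continuous.prodMk (continuous_pi fun x => ?_) (continuous_pi fun x => ?_)
    · exact continuous_discrete_rng.2 fun y => isOpen_aut_eq x y
    · refine continuous_discrete_rng.2 fun y => ?_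
      convert isOpen_aut_eq y x using 1
      ext σ
      exact (Equiv.symm_apply_eq _).trans eq_comm
  have hind : IsInducing Φ := by
    refine isInducing_iff_nhds.2 fun σ => le_antisymm (hcont.tendsto σ).le_comap fun S hS => ?_
    obtain ⟨U, hUS, hU, hσ⟩ := mem_nhds_iff.1 hS
    obtain ⟨F, hF⟩ := isOpen_exp_iff.1 hU σ hσ
    have h1 : (⋂ x ∈ F, {p : (N → N) × (N → N) | p.1 x = σ.toAutGraph.aut x}) ∈ 𝓝 (Φ σ) := by
      refine (Filter.biInter_finset_mem F).2 fun x _ => IsOpen.mem_nhds ?_ rfl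
      exact (isOpen_discrete {σ.toAutGraph.aut x}).preimage (f := fun p : (N → N) × (N → N) => p.1 x)
        ((continuous_apply x).comp continuous_fst)
    refine ⟨_, h1, fun σ' hσ' => hUS (hF σ' fun x hx => ?_)⟩
    exact Set.mem_iInter₂.1 hσ' x hx
  have hinj : Function.Injective Φ := fun σ τ e =>
    Exp.ext_aut fun x => congrFun (congrArg Prod.fst e) x
  have hrange : Set.range Φ = (⋂ x : N, ⋂ y : N, {p | p.1 x = y → p.2 y = x}) ∩
      ((⋂ x : N, ⋂ y : N, {p | p.2 x = y → p.1 y = x}) ∩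
        ⋂ x : N, ⋂ y : N, {p | σ₀.toAutGraph.Adj (p.1 x) (p.1 y) ↔ σ₀.toAutGraph.Adj x y}) := by
    ext p
    simp only [Set.mem_range, Set.mem_inter_iff, Set.mem_iInter, Set.mem_ofPred_eq]
    constructor
    · rintro ⟨σ, rfl⟩
      refine ⟨?_, ?_, fun x y => σ.toAutGraph.adj_aut x y⟩
      · rintro x _ rfl
        exact σ.toAutGraph.aut.symm_apply_apply x
      · rintro x _ rfl
        exact σ.toAutGraph.aut.apply_symm_apply x
    · rintro ⟨h1, h2, h3⟩
      let X : AutGraph N :=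
        { σ₀.toAutGraph.toSimpleGraph with
          aut := ⟨p.1, p.2, fun x => h1 x _ rfl, fun x => h2 x _ rfl⟩
          adj_aut := h3 }
      exact ⟨Exp.ofAutGraph X (fun _ _ => Iff.rfl) σ₀.isRandom, rfl⟩
  have hclosed : IsClosed (Set.range Φ) := by
    have c1 : ∀ x : N, Continuous fun p : (N → N) × (N → N) => p.1 x := fun x =>
      (continuous_apply x).comp continuous_fst
    have c2 : ∀ x : N, Continuous fun p : (N → N) × (N → N) => p.2 x := fun x =>
      (continuous_apply x).comp continuous_snd
    rw [hrange]
    refine .inter (isClosed_iInter fun x => isClosed_iInter fun y => ?_)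
      (.inter (isClosed_iInter fun x => isClosed_iInter fun y => ?_)
        (isClosed_iInter fun x => isClosed_iInter fun y => ?_))
    · exact isClosed_imp ((isOpen_discrete {y}).preimage (c1 x))
        ((isClosed_discrete {x}).preimage (c2 y))
    · exact isClosed_imp ((isOpen_discrete {y}).preimage (c2 x))
        ((isClosed_discrete {x}).preimage (c1 y))
    · exact (isClosed_discrete
        {q : N × N | σ₀.toAutGraph.Adj q.1 q.2 ↔ σ₀.toAutGraph.Adj x y}).preimage
          ((c1 x).prodMk (c1 y))
  have : IsCompletelyMetrizableSpace (Exp N randomGraphAut) :=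
    IsClosedEmbedding.IsCompletelyMetrizableSpace ⟨⟨hind, hinj⟩, hclosed⟩
  infer_instance

instance countable_autGraph_fin (n : ℕ) : Countable (AutGraph (Fin n)) := by
  have : Function.Injective fun X : AutGraph (Fin n) => (X.Adj, X.aut) := by
    rintro ⟨⟨A, _, _⟩, f, _⟩ ⟨⟨B, _, _⟩, g, _⟩ h
    simp only [Prod.mk.injEq] at h
    obtain ⟨rfl, rfl⟩ := h
    rfl
  exact this.countable

/-- Generic automorphisms are comeagre. -/
theorem isGenericAut_mem_residual [Countable N] :
    {σ : Exp N randomGraphAut | IsGenericAut σ.toAutGraph} ∈ residual (Exp N randomGraphAut) := by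
  have hA : ∀ x : N, {σ : Exp N randomGraphAut | ∃ k : ℕ, 0 < k ∧ (σ.toAutGraph.aut ^ k) x = x} ∈
      residual (Exp N randomGraphAut) := by
    intro x
    refine residual_of_dense_open (isOpen_exp_iff.2 ?_) (dense_exp fun σ F => ?_)
    · rintro σ ⟨k, hk, h⟩
      classical
      refine ⟨(Finset.range k).image fun i => (σ.toAutGraph.aut ^ i) x, fun σ' hσ' => ⟨k, hk, ?_⟩⟩
      have : ∀ i ≤ k, (σ'.toAutGraph.aut ^ i) x = (σ.toAutGraph.aut ^ i) x := by
        intro i hi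
        induction i with
        | zero => rfl
        | succ i ih =>
          rw [pow_succ', pow_succ', Equiv.Perm.mul_apply, ih (by omega), Equiv.Perm.mul_apply]
          exact hσ' _ (Finset.mem_image.2 ⟨i, Finset.mem_range.2 (by omega), rfl⟩)
      rw [this k le_rfl, h]
    · classical
      obtain ⟨X, h1, h2, h3⟩ := exists_aut_finite_orbits σ.isRandom (insert x F)
      refine ⟨Exp.ofAutGraph X (fun a b => by rw [h1]; rfl) (h1 ▸ σ.isRandom),
        h3 x (Finset.mem_insert_self _ _), fun y hy => h2 y (Finset.mem_insert_of_mem hy)⟩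
  have hB : ∀ (n : ℕ) (Y : AutGraph (Fin n)) (P : Set (Fin n)) (c : Fin n → N),
      {σ : Exp N randomGraphAut | (∀ x, Y.aut x ∈ P ↔ x ∈ P) → PreservesOn Y σ.toAutGraph c P →
        ∃ e : Fin n → N, PreservesOn Y σ.toAutGraph e Set.univ ∧ ∀ p ∈ P, e p = c p} ∈
      residual (Exp N randomGraphAut) := by
    intro n Y P c
    have transfer : ∀ (e : Fin n → N) (σ σ' : Exp N randomGraphAut) (Q : Set (Fin n)),
        (∀ x, σ'.toAutGraph.aut (e x) = σ.toAutGraph.aut (e x)) →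
          PreservesOn Y σ.toAutGraph e Q → PreservesOn Y σ'.toAutGraph e Q :=
      fun e σ σ' Q h H => ⟨H.inj, H.adj, fun x hx hx' => (H.aut x hx hx').trans (h x).symm⟩
    refine residual_of_dense_open (isOpen_exp_iff.2 ?_) (dense_exp fun σ F => ?_)
    · classical
      intro σ hσ
      -- If the hypotheses hold, a witness `e` persists as long as the values on its range do; if
      -- they fail, they keep failing as long as the values on the range of `c` do.
      by_cases h : (∀ x, Y.aut x ∈ P ↔ x ∈ P) ∧ PreservesOn Y σ.toAutGraph c P
      · obtain ⟨e, he, he'⟩ := hσ h.1 h.2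
        refine ⟨Finset.univ.image e, fun σ' hσ' _ _ => ⟨e, transfer e σ σ' _ (fun x => hσ' _
          (Finset.mem_image_of_mem _ (Finset.mem_univ _))) he, he'⟩⟩
      · refine ⟨Finset.univ.image c, fun σ' hσ' h1 h2 => absurd ⟨h1, transfer c σ' σ _ (fun x =>
          (hσ' _ (Finset.mem_image_of_mem _ (Finset.mem_univ _))).symm) h2⟩ h⟩
    · by_cases h : (∀ x, Y.aut x ∈ P ↔ x ∈ P) ∧ PreservesOn Y σ.toAutGraph c P
      · obtain ⟨X, h1, h2, e, he, he'⟩ := exists_aut_extension σ.isRandom F h.1 h.2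
        refine ⟨Exp.ofAutGraph X (fun a b => by rw [h1]; rfl) (h1 ▸ σ.isRandom),
          fun _ _ => ⟨e, ?_, he'⟩, h2⟩
        rwa [Exp.toAutGraph_ofAutGraph]
      · exact ⟨σ, fun h1 h2 => absurd ⟨h1, h2⟩ h, fun _ _ => rfl⟩
  have hA' := (eventually_countable_forall (l := residual (Exp N randomGraphAut))).2 hA
  have hB' := (eventually_countable_forall (l := residual (Exp N randomGraphAut))
    (p := fun σ (t : Σ n : ℕ, AutGraph (Fin n) × Set (Fin n) × (Fin n → N)) =>
      (∀ x, t.2.1.aut x ∈ t.2.2.1 ↔ x ∈ t.2.2.1) →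
        PreservesOn t.2.1 σ.toAutGraph t.2.2.2 t.2.2.1 →
        ∃ e : Fin t.1 → N, PreservesOn t.2.1 σ.toAutGraph e Set.univ ∧
          ∀ p ∈ t.2.2.1, e p = t.2.2.2 p)).2 fun t => hB t.1 t.2.1 t.2.2.1 t.2.2.2
  filter_upwards [hA', hB'] with σ h1 h2
  exact ⟨h1, fun n Y P c => h2 ⟨n, Y, P, c⟩⟩

/-- Generic automorphisms are dense. -/
theorem exists_isGenericAut [Countable N] (σ : Exp N randomGraphAut) (F : Finset N) :
    ∃ τ : Exp N randomGraphAut, IsGenericAut τ.toAutGraph ∧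
      ∀ x ∈ F, τ.toAutGraph.aut x = σ.toAutGraph.aut x := by
  have := baireSpace_exp σ
  have hopen : IsOpen {τ : Exp N randomGraphAut |
      ∀ x ∈ F, τ.toAutGraph.aut x = σ.toAutGraph.aut x} :=
    isOpen_exp_iff.2 fun τ hτ => ⟨F, fun τ' h x hx => (h x hx).trans (hτ x hx)⟩
  obtain ⟨τ, h1, h2⟩ := (dense_of_mem_residual isGenericAut_mem_residual).inter_open_nonempty _
    hopen ⟨σ, fun _ _ => rfl⟩
  exact ⟨τ, h2, h1⟩

/-- The conjugates of `τ` include all generic automorphisms, a comeagre set. -/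
theorem IsGenericAut.isTrussGeneric [Countable N] {τ : Exp N randomGraphAut}
    (hτ : IsGenericAut τ.toAutGraph) : IsTrussGeneric τ := by
  have := τ.isRandom.nonempty
  refine Filter.mem_of_superset isGenericAut_mem_residual fun σ hσ => ?_
  obtain ⟨e, he1, he2⟩ := hτ.exists_equiv (Y := σ.toAutGraph) hσ
  have hrel : ∀ {n : ℕ} (r : Language.graph.Relations n) (x : Fin n → N),
      RelMap r (e ∘ x) ↔ RelMap r x := by
    rintro n s x
    cases s
    have hx : x = ![x 0, x 1] := List.ofFn_inj.1 rfl
    have hx' : e ∘ x = ![e (x 0), e (x 1)] := List.ofFn_inj.1 rfl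
    refine (iff_of_eq (congrArg (RelMap adj) hx')).trans ((he1 _ _).trans ?_)
    exact iff_of_eq (congrArg (RelMap adj) hx.symm)
  refine ⟨⟨e, fun s => s.elim, hrel⟩, autLang_structure_ext (fun x => ?_) (fun x => ?_)⟩
  · refine Eq.trans ?_ (congrArg (fun y => e (τ.str.funMap AutFunctions.f y))
      (show ![e.symm x] = e.symm ∘ ![x] from List.ofFn_inj.1 rfl))
    have := he2 (e.symm x)
    rw [Equiv.apply_symm_apply] at this
    exact this.symm
  · refine Eq.trans ?_ (congrArg (fun y => e (τ.str.funMap AutFunctions.fInv y))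
      (show ![e.symm x] = e.symm ∘ ![x] from List.ofFn_inj.1 rfl))
    change σ.toAutGraph.aut.symm x = e (τ.toAutGraph.aut.symm (e.symm x))
    rw [Equiv.symm_apply_eq, ← he2, Equiv.apply_symm_apply, Equiv.apply_symm_apply]

end

/-! ### 1-diagrams and e-isolated points. -/

section

variable {N : Type u} [Language.graph.Structure N]

/-- The maps of `h` carry the witness of an existential formula from `σ` to `τ`; those of `h'` carry
a counterexample to a universal formula from `τ` to `σ`. -/
theorem diag₁_subset {σ τ : Exp N randomGraphAut} {n : ℕ} {b : Fin n → N}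
    (h : ∀ W : Set N, W.Finite → ∃ k : N → N, PreservesOn σ.toAutGraph τ.toAutGraph k W ∧ k ∘ b = b)
    (h' : ∀ W : Set N, W.Finite →
      ∃ k : N → N, PreservesOn τ.toAutGraph σ.toAutGraph k W ∧ k ∘ b = b) :
    diag₁ σ b ⊆ diag₁ τ b := by
  rintro φ ⟨hφ, hs⟩
  refine ⟨hφ, ?_⟩
  rcases hφ with hφ | hφ
  · by_contra hτ
    obtain ⟨W, hW, H⟩ := exists_finite_of_isUniversal.{u, 0, u} τ hφ b default hτ
    obtain ⟨k, hk, hkb⟩ := h' W hW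
    have := H N σ k hk
    rw [hkb, Subsingleton.elim (k ∘ default) default] at this
    exact this hs
  · obtain ⟨W, hW, H⟩ := exists_finite_of_isExistential.{u, 0, u} σ hφ b default hs
    obtain ⟨k, hk, hkb⟩ := h W hW
    have := H N τ k hk
    rwa [hkb, Subsingleton.elim (k ∘ default) default] at this

/-- The action of a generic automorphism on a finite invariant set determines the 1-diagram. -/
theorem diag₁_eq_of_preservesOn {τ α : Exp N randomGraphAut}
    (hτ : IsGenericAut τ.toAutGraph) (hα : IsEC α) {A : Set N} (hA : A.Finite)
    (hA' : ∀ x, τ.toAutGraph.aut x ∈ A ↔ x ∈ A) {k : N → N}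
    (hk : PreservesOn τ.toAutGraph α.toAutGraph k A) {n : ℕ} {b : Fin n → N} (hb : ∀ i, b i ∈ A)
    (hkb : k ∘ b = b) : diag₁ α b = diag₁ τ b := by
  have := τ.nonempty
  have h1 : ∀ W : Set N, W.Finite →
      ∃ h : N → N, PreservesOn τ.toAutGraph α.toAutGraph h W ∧ h ∘ b = b := by
    intro W hW
    -- Since `α` is only existentially closed, `τ` is first adjoined to it freely over `A`, and the
    -- required finite part of the amalgam is then absorbed.
    obtain ⟨D, Z, i, j, hi, hj, hij⟩ := exists_amalgam α.toAutGraph τ.toAutGraph A hA' k hk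
    obtain ⟨h, hh, hh'⟩ := hα.absorbs hi (hW.image j) (Set.finite_range b)
    refine ⟨h ∘ j, hh.comp (hj.mono (Set.subset_univ _)) (Set.mapsTo_image _ _), funext fun t => ?_⟩
    have : k (b t) = b t := congrFun hkb t
    rw [Function.comp_apply, Function.comp_apply, hij _ (hb t), this, hh' _ ⟨t, rfl⟩]
  have h2 : ∀ W : Set N, W.Finite →
      ∃ h : N → N, PreservesOn α.toAutGraph τ.toAutGraph h W ∧ h ∘ b = b := by
    intro W hW
    obtain ⟨h, hh, hh'⟩ := hτ.absorbs hA hA' hk hW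
    refine ⟨h, hh, funext fun t => ?_⟩
    have := hh' (b t) (hb t)
    rwa [show k (b t) = b t from congrFun hkb t] at this
  exact (diag₁_subset h2 h1).antisymm (diag₁_subset h1 h2)

/-- Existential quasifinite formulas are determined by the 1-diagram. -/
theorem SatQuasifinite.of_diag₁_eq [Countable N] {α β : Exp N randomGraphAut} {n m : ℕ}
    {b : Fin n → N} {p : Set (Language.graph.Formula (Fin n ⊕ Fin m))}
    {φ : graphAut.Formula (Fin n ⊕ Fin m)} (hφ : φ.IsQF) (h : SatQuasifinite α p φ b)
    (hαβ : diag₁ α b = diag₁ β b) : SatQuasifinite β p φ b := by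
  have := α.nonempty
  obtain ⟨y, hp, hy⟩ := h
  obtain ⟨W, hW, H⟩ := exists_finite_of_isQF.{u, 0, u} α hφ (Sum.elim b y) default
  have : Finite W := hW
  let t : Fin n ⊕ (Fin m ⊕ W) → N := Sum.elim b (Sum.elim y (fun x => x))
  -- `χ` asks for a copy of `y` together with the finite part that decides `φ`, and being
  -- existential it is visible in the 1-diagram. The possibly infinite type `p` comes for free, as
  -- homogeneity derives it from the equalities and adjacencies of the copy.
  let χ : graphAut.Formula (Fin n) := (diagFormula α.toAutGraph t).iExs (Fin m ⊕ W)
  have h1 : χ ∈ diag₁ α b := by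
    refine ⟨.inr (isExistential_iExs (isQF_diagFormula _ _)), ?_⟩
    let _ := expand (L := Language.graph) α.str
    exact Formula.realize_iExs.2 ⟨_, sat_diagFormula_self α t⟩
  rw [hαβ] at h1
  have h2 : ∃ z, Sat β.str (diagFormula α.toAutGraph t) (Sum.elim b z) := by
    let _ := expand (L := Language.graph) β.str
    exact Formula.realize_iExs.1 h1.2
  obtain ⟨z, hz⟩ := h2
  obtain ⟨k, hk, hk'⟩ := exists_preservesOn_of_sat hz
  have hkt : ∀ s, Sum.elim b (k ∘ y) s = k (Sum.elim b y s) := by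
    rintro (s | s)
    · exact (hk' (.inl s)).symm
    · rfl
  have hmem : ∀ s, Sum.elim b y s ∈ Set.range t := by
    rintro (s | s)
    · exact ⟨.inl s, rfl⟩
    · exact ⟨.inr (.inl s), rfl⟩
  refine ⟨k ∘ y, fun ξ hξ => ?_, ?_⟩
  · refine (realize_iff_of_same_diagram β (fun i j => ?_) ξ).1 (hp ξ hξ)
    rw [hkt, hkt]
    exact ⟨⟨fun e => congrArg k e, hk.inj _ (hmem i) _ (hmem j)⟩,
      (hk.adj _ (hmem i) _ (hmem j)).symm⟩
  · have h3 := (H N β k (Sum.elim b (k ∘ y))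
      (hk.mono fun w hw => ⟨.inr (.inr ⟨w, hw⟩), rfl⟩) fun s _ => hkt s).2 hy
    rwa [Subsingleton.elim (k ∘ default) default] at h3

theorem IsGenericAut.mem_Y [Countable N] {τ : Exp N randomGraphAut}
    (hτ : IsGenericAut τ.toAutGraph) : τ ∈ Y N randomGraphAut :=
  ⟨hτ.isEC, isSmooth τ⟩

/-- The isolating formula describes `τ` on `b` and a finite invariant set containing it, with an
empty type. A solution of it in an existentially closed `α` is a partial embedding fixing `b`, and
so forces the 1-diagram. -/
theorem IsGenericAut.isEIsolated {τ : Exp N randomGraphAut} (hτ : IsGenericAut τ.toAutGraph)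
    (hY : τ ∈ Y N randomGraphAut) {n : ℕ} (b : Fin n → N) :
    IsEIsolated (⟨diag₁ τ b, τ, hY, rfl⟩ : D randomGraphAut b) := by
  have := τ.nonempty
  obtain ⟨A, hA, hA1, hA2⟩ := hτ.exists_finite_invariant (Set.finite_range b)
  have : Finite A := hA1
  obtain ⟨m, ⟨ε⟩⟩ := Finite.exists_equiv_fin A
  let y : Fin m → N := fun t => ε.symm t
  refine isOpen_generateFrom_of_mem
    ⟨m, ∅, diagFormula τ.toAutGraph (Sum.elim b y), isQF_diagFormula _ _, ?_⟩
  ext d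
  constructor
  · rintro rfl
    exact ⟨τ, hY, ⟨y, by simp, sat_diagFormula_self _ _⟩, rfl⟩
  · rintro ⟨α, hα, ⟨z, -, hz⟩, hd⟩
    obtain ⟨k, hk, hk'⟩ := exists_preservesOn_of_sat hz
    refine D.ext (hd.symm.trans (diag₁_eq_of_preservesOn hτ hα.1 hA1 hA2
      (hk.mono fun a ha => ⟨.inr (ε ⟨a, ha⟩), by simp [y]⟩) (fun i => hA ⟨i, rfl⟩)
      (funext fun i => hk' (.inl i))))

/-- Membership in an open set of 1-diagrams depends on a finite part of the automorphism only. -/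
theorem exists_finset_of_isOpen [Countable N] {n : ℕ} {b : Fin n → N}
    {U : Set (D randomGraphAut b)} (hU : IsOpen U) {α : Exp N randomGraphAut} {d : D randomGraphAut b}
    (hd : d ∈ U) (hαd : diag₁ α b = d.diag) :
    ∃ F : Finset N, ∀ (β : Exp N randomGraphAut) (hβ : β ∈ Y N randomGraphAut),
      (∀ x ∈ F, β.toAutGraph.aut x = α.toAutGraph.aut x) →
        (⟨diag₁ β b, β, hβ, rfl⟩ : D randomGraphAut b) ∈ U := by
  classical
  induction hU with
  | basic U hU =>
    obtain ⟨m, p, φ, hφ, rfl⟩ := hU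
    -- The basic set contains `d` on account of some `α₁`, not of `α` itself; satisfaction passes to
    -- `α` because it depends on the 1-diagram only.
    obtain ⟨α₁, -, hα₁, e⟩ := hd
    obtain ⟨y, hp, hy⟩ := hα₁.of_diag₁_eq hφ (e.trans hαd.symm)
    obtain ⟨W, hW, H⟩ := exists_finite_of_isQF.{u, 0, u} α hφ (Sum.elim b y) default
    refine ⟨hW.toFinset, fun β hβ h => ⟨β, hβ, ⟨y, hp, ?_⟩, rfl⟩⟩
    exact (H N β id (Sum.elim b y) (preservesOn_id fun x hx => h x (hW.mem_toFinset.2 hx))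
      fun _ _ => rfl).2 hy
  | univ => exact ⟨∅, fun _ _ _ => trivial⟩
  | inter S T _ _ ihS ihT =>
    obtain ⟨F, hF⟩ := ihS hd.1
    obtain ⟨G, hG⟩ := ihT hd.2
    exact ⟨F ∪ G, fun β hβ h => ⟨hF β hβ fun x hx => h x (Finset.mem_union_left _ hx),
      hG β hβ fun x hx => h x (Finset.mem_union_right _ hx)⟩⟩
  | sUnion 𝒮 _ ih =>
    obtain ⟨S, hS, hdS⟩ := hd
    obtain ⟨F, hF⟩ := ih S hS hdS
    exact ⟨F, fun β hβ h => ⟨S, hS, hF β hβ h⟩⟩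

/-- A generic automorphism close to one representing a point of the open set has an e-isolated
1-diagram, still inside that set. -/
theorem dense_isEIsolated [Countable N] {n : ℕ} (b : Fin n → N) :
    Dense {d : D randomGraphAut b | IsEIsolated d} := by
  rw [dense_iff_inter_open]
  rintro U hU ⟨d, hd⟩
  obtain ⟨α, -, hα⟩ := d.exists_eq
  obtain ⟨F, hF⟩ := exists_finset_of_isOpen hU hd hα
  obtain ⟨τ, hτ, h⟩ := exists_isGenericAut α F
  exact ⟨_, hF τ hτ.mem_Y h, hτ.isEIsolated hτ.mem_Y b⟩

end

end TrussGeneric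

theorem mainTheorem9 {N : Type*} [Countable N] [FirstOrder.Language.graph.Structure N]
    (hN : N ⊨ TrussGeneric.randomGraph) :
    (∀ (n : ℕ) (b : Fin n → N),
      Dense {d : TrussGeneric.D TrussGeneric.randomGraphAut b | TrussGeneric.IsEIsolated d}) ∧
    ∃ τ : TrussGeneric.Exp N TrussGeneric.randomGraphAut, TrussGeneric.IsTrussGeneric τ := by
  obtain ⟨G, hG, hR⟩ := TrussGeneric.model_randomGraph_iff.1 hN
  -- The identity shows that `Exp` is nonempty, so that density yields a generic automorphism.
  let X : TrussGeneric.AutGraph N := { G with aut := Equiv.refl N, adj_aut := fun _ _ => Iff.rfl }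
  obtain ⟨τ, hτ, -⟩ := TrussGeneric.exists_isGenericAut (TrussGeneric.Exp.ofAutGraph X hG hR) ∅
  exact ⟨fun n b => TrussGeneric.dense_isEIsolated b, τ, hτ.isTrussGeneric⟩
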